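/- Let $q$ be a power of an odd prime and let $l\ge 1$ be the integer with $2^l\,\|\,(q+1)$, i.e. $2^l\mid q+1$ and $2^{l+1}\nmid q+1$. For $n\ge 1$ let $F_n=\mathbb F_{q^2}(x_0,\dots,x_n)$, where $x_0$ is transcendental over $\mathbb F_{q^2}$ and $$x_{i+1}^{\,q-1}+(x_i+1)^{q-1}=1\qquad(0\le i<n),$$ and let $F_0=\mathbb F_{q^2}(x_0)$. An $\mathbb F_{q^2}$-rational place is a place of degree one. For $1\le m\le n$, the number of $\mathbb F_{q^2}$-rational places of $F_n$ that are a zero of $x_m-\alpha$ for some $\alpha\in\mathbb F_q^*\setminus\{-1\}$ is $$\begin{cases} 2^{m-1}(q-1), & \text{if } m\le n/2 \text{ and } m\le l,\\ 0, & \text{if } m\le n/2 \text{ and } m>l,\\ 2^{n-m-1}(q-1), & \text{if } n/2<m<n \text{ and } n-m\le l,\\ 0, & \text{if } n/2<m<n \text{ and } n-m>l,\\ q-2, & \text{if } m=n. \end{cases}$$ Moreover, the number of $\mathbb F_{q^2}$-rational places of $F_n$ lying above the zero $P_{-1}$ of $x_0+1$ in $F_0$ is $$\begin{cases} (q-1)(2^{l+1}-1),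 & \text{if } n>2l,\\ (q-1)(2^{(n+1)/2}-1), & \text{if } n\le 2l \text{ and } n \text{ is odd},\\ (q-1)(3\cdot 2^{n/2-1}-1), & \text{if } n\le 2l \text{ and } n \text{ is even}. \end{cases}$$ -/

import Mathlib

noncomputable section

namespace KummerTower

/-- A place of a field `F` over the constant field `K`, given by its valuation ring `O`,
a valuation ring of `F` with `K ⊆ O ⊊ F`. -/
@[ext]
structure Place (K F : Type*) [Field K] [Field F] [Algebra K F] where
  /-- The valuation ring of the place. -/
  ring : ValuationSubring F
  algebraMap_mem : ∀ c : K, algebraMap K F c ∈ ring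
  ne_top : ring ≠ ⊤

namespace Place

variable {K F : Type*} [Field K] [Field F] [Algebra K F]

/-- The residue class field `O / P` of a place. -/
abbrev ResidueField (P : Place K F) : Type _ := IsLocalRing.ResidueField P.ring

/-- The embedding of the constant field into the residue class field. -/
def residueMap (P : Place K F) : K →+* P.ResidueField :=
  (IsLocalRing.residue P.ring).comp ((algebraMap K F).codRestrict P.ring P.algebraMap_mem)

/-- The degree `[O / P : K]` of a place (zero if it is infinite). -/
def degree (P : Place K F) : ℕ :=
  @Module.finrank K P.ResidueField _ _ P.residueMap.toAlgebra.toModule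

/-- A `K`-rational place is a place of degree one. -/
def IsRational (P : Place K F) : Prop := P.degree = 1

/-- `P` is a zero of `f`: the value of `f` at `P` is positive, which in the multiplicative
notation for valuations says that the valuation of `f` is smaller than `1`. -/
def IsZero (P : Place K F) (f : F) : Prop := P.ring.valuation f < 1

/-- `Q`, a place of `F`, lies above `P`, a place of `E`, along the embedding `i : E → F`:
the valuation ring of `P` is the intersection of `E` with the valuation ring of `Q`. -/
def LiesAbove {E : Type*} [Field E] [Algebra K E] (Q : Place K F) (i : E →ₐ[K] F)
    (P : Place K E) : Prop :=
  Q.ring.comap (i : E →+* F) = P.ring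

end Place

/-- The sequence `x₀, x₁, …` of elements of an extension of `K` generates the tower:
`x₀` is transcendental over `K`, and `x_{i+1}^(q-1) + (x_i + 1)^(q-1) = 1` for all `i`. -/
structure IsTowerSequence (K : Type*) {Ω : Type*} [Field K] [Field Ω] [Algebra K Ω]
    (q : ℕ) (x : ℕ → Ω) : Prop where
  transcendental : Transcendental K (x 0)
  equation : ∀ i, x (i + 1) ^ (q - 1) + (x i + 1) ^ (q - 1) = 1

section Level

variable (K : Type*) {Ω : Type*} [Field K] [Field Ω] [Algebra K Ω] (x : ℕ → Ω)

/-- The `n`-th field `F_n = K(x₀, …, x_n)` of the tower. -/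
def level (n : ℕ) : IntermediateField K Ω := IntermediateField.adjoin K (x '' Set.Iic n)

theorem level_mono {m n : ℕ} (h : m ≤ n) : level K x m ≤ level K x n :=
  IntermediateField.adjoin.mono K _ _ (Set.image_mono (Set.Iic_subset_Iic.mpr h))

/-- The generator `x_m`, as an element of `F_n` for `m ≤ n`. -/
def gen {m n : ℕ} (h : m ≤ n) : level K x n :=
  ⟨x m, IntermediateField.subset_adjoin K _ ⟨m, h, rfl⟩⟩

/-- The embedding of `F_0` into `F_n`. -/
def baseEmbedding (n : ℕ) : level K x 0 →ₐ[K] level K x n :=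
  IntermediateField.inclusion (level_mono K x (Nat.zero_le n))

end Level

/-- Sequences generating the tower exist. -/
theorem exists_isTowerSequence (K : Type*) [Field K] {q : ℕ} (hq : 2 ≤ q) :
    ∃ x : ℕ → AlgebraicClosure (RatFunc K), IsTowerSequence K q x := by
  have hroot : ∀ a : AlgebraicClosure (RatFunc K),
      ∃ b, b ^ (q - 1) = 1 - (a + 1) ^ (q - 1) := fun a =>
    IsAlgClosed.exists_pow_nat_eq _ (by omega)
  choose f hf using hroot
  refine ⟨fun n => Nat.rec (algebraMap _ _ (RatFunc.X : RatFunc K)) (fun _ a => f a) n, ?_, ?_⟩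
  · exact (transcendental_algebraMap_iff
      (algebraMap (RatFunc K) (AlgebraicClosure (RatFunc K))).injective).mpr
      RatFunc.transcendental_X
  · intro i
    change f _ ^ (q - 1) + _ = 1
    rw [hf]
    exact sub_add_cancel _ _

end KummerTower

end

/-!
Write `N = q - 1` and `u_i = x_i + 1`. At a place where `x_m` has a residue `α ∈ 𝔽_q` different from
`0` and `-1`, the equations of the tower force `x_i ≡ -1` for `i < m` and `x_i ≡ 0` for `i > m`. Put
`z_i = x_{m+i} / u_{m-i}`. The equations give the exact relations `z_1 ^ N = x_m / (1 + x_m)` and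
`z_{i+1} ^ N * (1 + x_{m+i}) * x_{m-i+1} ^ N = z_i * (1 + x_{m+i-1}) ^ N * x_{m-i}`, so for `i ≤ j =
min m (n - m)` the `z_i` are units at the place, with residues `c_i` satisfying `c_1 ^ N = α / (1 +
α)` and `c_{i+1} ^ N = -c_i`. All the residues can be recovered from `c = c_j`: `c_i = -c ^ (N ^ (j
- i))` for `1 ≤ i < j`, and `α / (1 + α) = c ^ (N ^ j)`.

The main point is that the rational places in question correspond bijectively to the `c` in `𝔽_{q²}`
with `c ^ (N ^ j) ∈ 𝔽_q \ {0, 1}` (`encard_rationalZeros`).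

* Uniqueness and rationality. The local ring generated at the place by the `x_i` and the `z_i` is
  Noetherian. Modulo `t = x_0 + 1` (if `n = m + j`) or modulo `t = x_n` (if `j = m`) all these
  generators become constant: this is a computation in an arbitrary local ring, which uses only that
  an `N`-th root with a given residue is unique (`const_of_isLocalRing`). Hence the maximal ideal is
  generated by `t`, so the local ring is a valuation ring and coincides with the ring of the place
  (`valuationSubring_of_adjoin`).
* Existence. Residues are prescribed one generator at a time, extending a valuation ring from `F_r`
  to `F_{r+1}` (`exists_valuationSubring_root`). This needs the degree of `F_{r+1}` over `F_r` to be
  `N`, which is Eisenstein's criterion at the place of `F_r` where all `x_i` vanish; by the same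
  local argument `x_r` is a uniformizer there (`eq_zero_of_eval_eq_zero`).

For `j ≥ 1` the condition on `c` amounts to `c ^ (N ^ j) = -1`, since a nonzero element of `𝔽_q`
which is an `N`-th power in `𝔽_{q²}` has square one. In the cyclic group of order `q² - 1` this
equation has `gcd (q² - 1) (N ^ j) = 2 ^ (j - 1) * N` solutions if `j ≤ l`, and none otherwise
(`encard_pow_eq_neg_one`). A rational place above the zero of `x_0 + 1` either has `x_i ≡ -1` for
all `i`, which happens for exactly one place, or is of the above kind for exactly one `m`; summing
over `m` gives the second count.
-/

noncomputable section

namespace KummerTower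

/-! ### Rational places and the existence of valuation rings -/

section

open Polynomial

theorem Place.isRational_iff {K F : Type*} [Field K] [Field F] [Algebra K F] (P : Place K F) :
    P.IsRational ↔ ∀ f, P.ring.valuation f ≤ 1 →
      ∃ c : K, P.ring.valuation (f - algebraMap K F c) < 1 := by
  let _ : Algebra K P.ResidueField := P.residueMap.toAlgebra
  have hres : ∀ (f : P.ring) (c : K), P.ring.valuation ((f : F) - algebraMap K F c) < 1 ↔
      P.residueMap c = IsLocalRing.residue P.ring f := by
    intro f c
    have h := P.ring.valuation_lt_one_iff (f - ⟨algebraMap K F c, P.algebraMap_mem c⟩)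
    rw [← IsLocalRing.residue_eq_zero_iff, map_sub, sub_eq_zero] at h
    exact h.symm.trans eq_comm
  have h1 : P.IsRational ↔ Function.Surjective P.residueMap := by
    have hd : P.IsRational ↔ Module.finrank K P.ResidueField = 1 := Iff.rfl
    rw [hd]
    constructor
    · intro h y
      obtain ⟨c, hc⟩ := (finrank_eq_one_iff_of_nonzero' (1 : P.ResidueField) one_ne_zero).mp h y
      exact ⟨c, by rwa [Algebra.smul_def, mul_one] at hc⟩
    · intro h
      refine (finrank_eq_one_iff_of_nonzero' (1 : P.ResidueField) one_ne_zero).mpr fun y => ?_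
      obtain ⟨c, hc⟩ := h y
      exact ⟨c, by rw [Algebra.smul_def, mul_one]; exact hc⟩
  rw [h1]
  constructor
  · intro h f hf
    obtain ⟨c, hc⟩ := h (IsLocalRing.residue P.ring ⟨f, P.ring.mem_of_valuation_le_one f hf⟩)
    exact ⟨c, (hres ⟨f, _⟩ c).mpr hc⟩
  · intro h y
    obtain ⟨f, rfl⟩ := IsLocalRing.residue_surjective y
    obtain ⟨c, hc⟩ := h f (P.ring.valuation_le_one f)
    exact ⟨c, (hres f c).mp hc⟩

/-- Existence of places: if the kernel of `f : R → Ω` is contained in the kernel of a homomorphism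
`g` to a field, then the `f r` with `g r = 0` form a proper ideal of the range of `f`, so some
valuation ring of `Ω` contains the range and has this ideal among its nonunits. -/
theorem exists_valuationSubring_of_ker_le {R κ Ω : Type*} [CommRing R] [Field κ] [Field Ω]
    (f : R →+* Ω) (g : R →+* κ) (h : RingHom.ker f ≤ RingHom.ker g) :
    ∃ V : ValuationSubring Ω, ∀ r, V.valuation (f r) ≤ 1 ∧ (g r = 0 → V.valuation (f r) < 1) := by
  have hs : Function.Surjective f.rangeRestrict := f.rangeRestrict_surjective
  have hI : (RingHom.ker g).map f.rangeRestrict ≠ ⊤ := by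
    rw [Ne, Ideal.eq_top_iff_one, Ideal.mem_map_iff_of_surjective _ hs]
    rintro ⟨r, hr, hr1⟩
    have h1 : f r = 1 := congrArg Subtype.val hr1
    have h2 : r - 1 ∈ RingHom.ker g := h (by rw [RingHom.mem_ker, map_sub, h1, map_one, sub_self])
    rw [RingHom.mem_ker, map_sub, (RingHom.mem_ker).mp hr, map_one, zero_sub, neg_eq_zero] at h2
    exact one_ne_zero h2
  obtain ⟨V, hV, hV'⟩ := Ideal.image_subset_nonunits_valuationSubring _ hI
  refine ⟨V, fun r => ⟨(V.valuation_le_one_iff _).mpr (hV ⟨r, rfl⟩), fun hr => ?_⟩⟩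
  exact hV' ⟨f.rangeRestrict r, Ideal.mem_map_of_mem _ hr, rfl⟩

/-- Lifting a root in the residue field to a place: let `z` be a root of `Z ^ N - a`, where `1, z,
…, z ^ (N - 1)` are linearly independent over `E`, and let `c ∈ E` reduce to a root of the same
polynomial at `V`. Then the restriction of `V` to `E` extends to a valuation ring at which `z`
reduces to `c`. Indeed `W[z] = W[Z] / (Z ^ N - a)` for `W = V ∩ E`, and `Z ↦ c` defines a
homomorphism from it to the residue field of `V`. -/
theorem exists_valuationSubring_root {Ω : Type*} [Field Ω] (E : Subfield Ω)
    (V : ValuationSubring Ω) {N : ℕ} {z a c : Ω} (ha : a ∈ E) (hc : c ∈ E) (hz : z ^ N = a)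
    (hN : N ≠ 0)
    (hirr : ∀ P : E[X], P.degree < N → P.eval₂ E.subtype z = 0 → P = 0)
    (hcV : V.valuation c ≤ 1) (hac : V.valuation (a - c ^ N) < 1) :
    ∃ V' : ValuationSubring Ω, (∀ f ∈ E, V'.valuation f ≤ 1 ↔ V.valuation f ≤ 1) ∧
      (∀ f ∈ E, V'.valuation f < 1 ↔ V.valuation f < 1) ∧ V'.valuation (z - c) < 1 := by
  have haV : V.valuation a ≤ 1 := by
    have : a = (a - c ^ N) + c ^ N := by ring
    rw [this]
    exact (V.valuation.map_add _ _).trans (max_le hac.le (by rw [map_pow]; exact pow_le_one' hcV N))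
  let W : Subring Ω := V.toSubring ⊓ E.toSubring
  let iE : W →+* E := Subring.inclusion inf_le_right
  let iV : W →+* V := Subring.inclusion inf_le_left
  let aW : W := ⟨a, (V.valuation_le_one_iff a).mp haV, ha⟩
  let cW : W := ⟨c, (V.valuation_le_one_iff c).mp hcV, hc⟩
  let ρ : W →+* IsLocalRing.ResidueField V := (IsLocalRing.residue V).comp iV
  have hρ : ∀ w : W, ρ w = 0 ↔ V.valuation (w : Ω) < 1 := fun w => by
    rw [← show ((iV w : V) : Ω) = w from rfl, ← V.valuation_lt_one_iff,
      ← IsLocalRing.residue_eq_zero_iff]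
    rfl
  let f : W[X] →+* Ω := eval₂RingHom W.subtype z
  let g : W[X] →+* IsLocalRing.ResidueField V := eval₂RingHom ρ (ρ cW)
  have hker : RingHom.ker f ≤ RingHom.ker g := by
    intro P hP
    have hmon : (X ^ N - C aW : W[X]).Monic := monic_X_pow_sub_C aW hN
    have hfQ : f (X ^ N - C aW) = 0 := by
      simp [f, aW, hz]
    have hgQ : g (X ^ N - C aW) = 0 := by
      have : ρ (cW ^ N - aW) = 0 := by
        rw [hρ, ← Valuation.map_neg]
        simpa [aW, cW] using hac
      simpa [g] using this
    have hmod : P %ₘ (X ^ N - C aW) = 0 := by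
      have h0 : (P %ₘ (X ^ N - C aW)).map iE = 0 := by
        apply hirr
        · refine degree_map_le.trans_lt ?_
          have := degree_modByMonic_lt P hmon
          rwa [degree_X_pow_sub_C (Nat.pos_of_ne_zero hN)] at this
        · rw [eval₂_map]
          have h1 : f (P %ₘ (X ^ N - C aW)) = 0 := by
            have h2 := congrArg f (modByMonic_add_div P (X ^ N - C aW))
            rwa [map_add, map_mul, hfQ, zero_mul, add_zero, RingHom.mem_ker.mp hP] at h2
          exact h1
      exact (Polynomial.map_eq_zero_iff (Subring.inclusion_injective _)).mp h0
    rw [RingHom.mem_ker, ← modByMonic_add_div P (X ^ N - C aW), hmod, zero_add, map_mul, hgQ,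
      zero_mul]
  obtain ⟨V', hV'⟩ := exists_valuationSubring_of_ker_le f g hker
  have hW1 : ∀ u ∈ E, V.valuation u ≤ 1 → V'.valuation u ≤ 1 := fun u huE hu => by
    simpa [f] using (hV' (C ⟨u, (V.valuation_le_one_iff u).mp hu, huE⟩)).1
  have hW2 : ∀ u ∈ E, V.valuation u < 1 → V'.valuation u < 1 := fun u huE hu => by
    have := (hV' (C ⟨u, (V.valuation_le_one_iff u).mp hu.le, huE⟩)).2
      (by simpa [g] using (hρ ⟨u, (V.valuation_le_one_iff u).mp hu.le, huE⟩).mpr hu)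
    simpa [f] using this
  refine ⟨V', fun u hu => ⟨fun h => ?_, hW1 u hu⟩, fun u hu => ⟨fun h => ?_, hW2 u hu⟩, ?_⟩
  · by_contra hlt
    have h0 : u ≠ 0 := by rintro rfl; simp at hlt
    have := hW2 u⁻¹ (E.inv_mem hu) (by rw [map_inv₀]; exact inv_lt_one_of_one_lt₀ (not_le.mp hlt))
    rw [map_inv₀] at this
    exact absurd this (not_lt.mpr ((one_le_inv₀ ((Valuation.pos_iff _).mpr h0)).mpr h))
  · by_contra hlt
    have h0 : u ≠ 0 := by rintro rfl; simp at hlt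
    have := hW1 u⁻¹ (E.inv_mem hu) (by rw [map_inv₀]; exact inv_le_one_of_one_le₀ (not_lt.mp hlt))
    rw [map_inv₀] at this
    exact absurd h (not_lt.mpr ((inv_le_one₀ ((Valuation.pos_iff _).mpr h0)).mp this))
  · have := (hV' (X - C cW)).2 (by simp [g])
    simpa [f, cW] using this

end

/-! ### Valuation rings with an explicit uniformizer -/

universe u

/-- Criterion for the local ring of `K[G]` at the center of `V` to be all of `V`: it suffices that
modulo an element `t` of the center every generator becomes constant. The hypothesis `h` expresses
the latter through homomorphisms `ψ` from `K[G]` to local rings that kill `t` and pull back the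
maximal ideal to the center. In that case `t` generates the maximal ideal of `V` and all residues
are constants. -/
theorem valuationSubring_of_adjoin {K : Type*} {F : Type u} [Field K] [Field F] [Algebra K F]
    {G : Set F} (hG : G.Finite)
    (hfrac : ∀ f : F, ∃ a ∈ Algebra.adjoin K G, ∃ b ∈ Algebra.adjoin K G, f = a / b)
    (V : ValuationSubring F) (hA : ∀ a ∈ Algebra.adjoin K G, V.valuation a ≤ 1)
    (t : Algebra.adjoin K G) (ht : V.valuation (t : F) < 1)
    (h : ∀ (R : Type u) [CommRing R] [IsLocalRing R] (ψ : Algebra.adjoin K G →+* R),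
      (∀ a, IsUnit (ψ a) ↔ V.valuation (a : F) = 1) → ψ t = 0 →
      ∀ g (hg : g ∈ G), ∃ c : K,
        ψ ⟨g, Algebra.subset_adjoin hg⟩ = ψ (algebraMap K (Algebra.adjoin K G) c)) :
    (∀ f, V.valuation f ≤ 1 → ∃ a ∈ Algebra.adjoin K G, ∃ b ∈ Algebra.adjoin K G,
      V.valuation b = 1 ∧ f = a / b) ∧
    (∀ f, V.valuation f < 1 → ∃ u, V.valuation u ≤ 1 ∧ f = t * u) ∧
    (∀ f, V.valuation f ≤ 1 → ∃ c : K, V.valuation (f - algebraMap K F c) < 1) := by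
  let A := (Algebra.adjoin K G).toSubring
  have hAV : A ≤ V.toSubring := fun a ha => (V.valuation_le_one_iff a).mp (hA a ha)
  let P : Ideal A := (IsLocalRing.maximalIdeal V).comap (Subring.inclusion hAV)
  have hP : ∀ a : A, a ∈ P ↔ V.valuation (a : F) < 1 := fun a =>
    V.valuation_lt_one_iff (Subring.inclusion hAV a)
  have hPc : ∀ a : A, a ∈ P.primeCompl ↔ V.valuation (a : F) = 1 := fun a => by
    rw [Ideal.mem_primeCompl_iff, hP, not_lt]
    exact ⟨fun h1 => le_antisymm (hA a a.2) h1, fun h1 => h1.ge⟩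
  let L := (LocalSubring.ofPrime A P).toSubring
  have hAL : A ≤ L := LocalSubring.le_ofPrime A P
  have hLoc : IsLocalization.AtPrime L P := inferInstance
  have hNA : IsNoetherianRing A := by
    have : Algebra.FiniteType K (Algebra.adjoin K G) :=
      (Subalgebra.fg_iff_finiteType _).mp ⟨hG.toFinset, by simp⟩
    exact Algebra.FiniteType.isNoetherianRing K (Algebra.adjoin K G)
  have hNL : IsNoetherianRing L := IsLocalization.isNoetherianRing P.primeCompl L hNA
  have hmk : ∀ f : L, ∃ a ∈ Algebra.adjoin K G, ∃ b ∈ Algebra.adjoin K G,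
      V.valuation b = 1 ∧ (f : F) = a / b := by
    intro f
    obtain ⟨⟨a, b⟩, hab⟩ := IsLocalization.surj P.primeCompl f
    have hb : V.valuation ((b : A) : F) = 1 := (hPc b).mp b.2
    have hb0 : ((b : A) : F) ≠ 0 := by intro h0; simp [h0] at hb
    refine ⟨a, a.2, (b : A), (b : A).2, hb, ?_⟩
    rw [eq_div_iff hb0]
    exact congrArg Subtype.val hab
  have hLV : ∀ f : L, V.valuation (f : F) ≤ 1 := by
    intro f
    obtain ⟨a, ha, b, -, hb, hf⟩ := hmk f
    rw [hf, map_div₀, hb, div_one]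
    exact hA a ha
  have hunit : ∀ f : L, IsUnit f ↔ V.valuation (f : F) = 1 := by
    intro f
    constructor
    · intro hu
      obtain ⟨g, hg⟩ := isUnit_iff_exists_inv.mp hu
      have h1 : V.valuation (f : F) * V.valuation (g : F) = 1 := by
        rw [← map_mul, ← map_one V.valuation]
        exact congrArg V.valuation (congrArg Subtype.val hg)
      refine le_antisymm (hLV f) (not_lt.mp fun hlt => ?_)
      exact absurd h1 (mul_lt_one_of_lt_of_le hlt (hLV g)).ne
    · intro hf
      obtain ⟨a, ha, b, hb, hb1, hfab⟩ := hmk f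
      have ha1 : V.valuation a = 1 := by rw [hfab, map_div₀, hb1, div_one] at hf; exact hf
      have hau : IsUnit (algebraMap A L ⟨a, ha⟩) :=
        (IsLocalization.AtPrime.isUnit_to_map_iff L P ⟨a, ha⟩).mpr ((hPc _).mpr ha1)
      have hb0 : b ≠ 0 := by intro h0; simp [h0] at hb1
      refine isUnit_of_mul_isUnit_left (y := algebraMap A L ⟨b, hb⟩) ?_
      convert hau
      apply Subtype.ext
      change (f : F) * b = a
      rw [hfab, div_mul_cancel₀ _ hb0]
  let tL : L := ⟨t, hAL t.2⟩
  have htL : ¬ IsUnit tL := fun hu => ht.ne ((hunit tL).mp hu)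
  have hne : Ideal.span {tL} ≠ ⊤ := fun h1 => htL (Ideal.span_singleton_eq_top.mp h1)
  have : Nontrivial (L ⧸ Ideal.span {tL}) := Ideal.Quotient.nontrivial_iff.mpr hne
  have : IsLocalRing (L ⧸ Ideal.span {tL}) :=
    IsLocalRing.of_surjective' (Ideal.Quotient.mk _) Ideal.Quotient.mk_surjective
  have hloc : IsLocalHom (Ideal.Quotient.mk (Ideal.span {tL})) :=
    IsLocalHom.of_surjective _ Ideal.Quotient.mk_surjective
  let ι : Algebra.adjoin K G →+* L := Subring.inclusion hAL
  let ψ : Algebra.adjoin K G →+* L ⧸ Ideal.span {tL} := (Ideal.Quotient.mk _).comp ι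
  have hψ : ∀ a, IsUnit (ψ a) ↔ V.valuation (a : F) = 1 := fun a => by
    rw [← show ((ι a : L) : F) = a from rfl, ← hunit]
    exact isUnit_map_iff (Ideal.Quotient.mk (Ideal.span {tL})) (ι a)
  have hψt : ψ t = 0 := Ideal.Quotient.eq_zero_iff_mem.mpr (Ideal.mem_span_singleton_self tL)
  have hcst : ∀ a (ha : a ∈ Algebra.adjoin K G), ∃ c : K,
      ψ ⟨a, ha⟩ = ψ (algebraMap K (Algebra.adjoin K G) c) := by
    intro a ha
    induction ha using Algebra.adjoin_induction with
    | mem g hg => exact h _ ψ hψ hψt g hg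
    | algebraMap r => exact ⟨r, rfl⟩
    | add x y hx hy h1 h2 =>
      obtain ⟨c, hc⟩ := h1
      obtain ⟨d, hd⟩ := h2
      refine ⟨c + d, ?_⟩
      rw [map_add, map_add, ← hc, ← hd, ← map_add]
      rfl
    | mul x y hx hy h1 h2 =>
      obtain ⟨c, hc⟩ := h1
      obtain ⟨d, hd⟩ := h2
      refine ⟨c * d, ?_⟩
      rw [map_mul, map_mul, ← hc, ← hd, ← map_mul]
      rfl
  have hconst : ∀ f : L, ∃ c : K,
      f - ι (algebraMap K (Algebra.adjoin K G) c) ∈ Ideal.span {tL} := by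
    intro f
    obtain ⟨a, ha, b, hb, hb1, hf⟩ := hmk f
    have hb0 : b ≠ 0 := by intro h0; simp [h0] at hb1
    obtain ⟨c, hc⟩ := hcst a ha
    obtain ⟨d, hd⟩ := hcst b hb
    have hfb : f * ι ⟨b, hb⟩ = ι ⟨a, ha⟩ := by
      apply Subtype.ext
      change (f : F) * b = a
      rw [hf, div_mul_cancel₀ _ hb0]
    have hd0 : d ≠ 0 := by
      rintro rfl
      rw [map_zero, map_zero] at hd
      have := (hψ ⟨b, hb⟩).mpr hb1
      rw [hd] at this
      exact not_isUnit_zero this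
    refine ⟨c / d, ?_⟩
    rw [← Ideal.Quotient.eq]
    have h1 : Ideal.Quotient.mk (Ideal.span {tL}) f * ψ ⟨b, hb⟩ = ψ ⟨a, ha⟩ := by
      exact (map_mul (Ideal.Quotient.mk _) f (ι ⟨b, hb⟩)).symm.trans (congrArg _ hfb)
    have h2 : ψ (algebraMap K _ (c / d)) * ψ ⟨b, hb⟩ = ψ ⟨a, ha⟩ := by
      rw [hd, hc, ← map_mul, ← map_mul, div_mul_cancel₀ _ hd0]
    exact ((hψ ⟨b, hb⟩).mpr hb1).mul_right_cancel (h1.trans h2.symm)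
  -- A nonunit is congruent modulo `t` to a constant, which can only be zero.
  have hmax : IsLocalRing.maximalIdeal L = Ideal.span {tL} := by
    refine le_antisymm (fun f hf => ?_) ?_
    · obtain ⟨c, hc⟩ := hconst f
      have hc0 : c = 0 := by
        by_contra hc0
        have hu : IsUnit (ι (algebraMap K _ c)) := 
          ((isUnit_iff_ne_zero.mpr hc0).map (algebraMap K (Algebra.adjoin K G))).map ι
        refine (IsLocalRing.mem_maximalIdeal _).mp ?_ hu
        have h1 := sub_mem hf (IsLocalRing.le_maximalIdeal hne hc)
        rwa [sub_sub_cancel] at h1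
      rwa [hc0, map_zero, map_zero, sub_zero] at hc
    · rw [Ideal.span_singleton_le_iff_mem]
      exact htL
  have hval : ValuationRing L :=
    ((tfae_of_isNoetherianRing_of_isLocalRing_of_isDomain L).out 4 1 rfl rfl).mp ⟨tL, hmax⟩
  -- The valuation ring `L` is dominated by `V`, hence equal to it.
  have hVL : ∀ f : F, V.valuation f ≤ 1 → f ∈ L := by
    intro f hf
    have hor : f ∈ L ∨ f⁻¹ ∈ L := by
      obtain ⟨a, ha, b, hb, rfl⟩ := hfrac f
      rcases eq_or_ne b 0 with rfl | hb0
      · left; simp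
      rcases eq_or_ne a 0 with rfl | ha0
      · left; simp
      obtain ⟨c, hc⟩ := ValuationRing.cond (⟨a, hAL ha⟩ : L) (⟨b, hAL hb⟩ : L)
      rcases hc with hc | hc
      · right
        have h1 : a * c = b := congrArg Subtype.val hc
        rw [inv_div, ← h1, mul_div_cancel_left₀ _ ha0]
        exact c.2
      · left
        have h1 : b * c = a := congrArg Subtype.val hc
        rw [← h1, mul_div_cancel_left₀ _ hb0]
        exact c.2
    rcases hor with h1 | h1
    · exact h1
    · rcases eq_or_ne f 0 with rfl | hf0
      · exact L.zero_mem
      have h2 : V.valuation f⁻¹ = 1 := by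
        refine le_antisymm (hLV ⟨_, h1⟩) ?_
        rw [map_inv₀]
        exact (one_le_inv₀ ((Valuation.pos_iff _).mpr hf0)).mpr hf
      obtain ⟨g, hg⟩ := isUnit_iff_exists_inv.mp ((hunit ⟨_, h1⟩).mpr h2)
      have h3 : f⁻¹ * g = 1 := congrArg Subtype.val hg
      rw [inv_mul_eq_one₀ hf0] at h3
      rw [h3]
      exact g.2
  refine ⟨fun f hf => hmk ⟨f, hVL f hf⟩, fun f hf => ?_, fun f hf => ?_⟩
  · have h1 : (⟨f, hVL f hf.le⟩ : L) ∈ Ideal.span {tL} := by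
      rw [← hmax]
      exact fun hu => hf.ne ((hunit _).mp hu)
    obtain ⟨u, hu⟩ := Ideal.mem_span_singleton'.mp h1
    refine ⟨u, hLV u, ?_⟩
    rw [mul_comm]
    exact (congrArg Subtype.val hu).symm
  · obtain ⟨c, hc⟩ := hconst ⟨f, hVL f hf⟩
    obtain ⟨u, hu⟩ := Ideal.mem_span_singleton'.mp hc
    refine ⟨c, ?_⟩
    have h1 : (u : F) * t = f - algebraMap K F c := congrArg Subtype.val hu
    rw [← h1, map_mul, mul_comm]
    exact mul_lt_one_of_lt_of_le ht (hLV u)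

/-- A valuation ring that is the localization of a subring `A` at its center is determined by the
residues of the elements of `A`. -/
theorem valuationSubring_eq_of_adjoin {K F : Type*} [Field K] [Field F] [Algebra K F]
    {A : Subalgebra K F} {V V' : ValuationSubring F}
    (h : ∀ f, V.valuation f ≤ 1 → ∃ a ∈ A, ∃ b ∈ A, V.valuation b = 1 ∧ f = a / b)
    (hA : ∀ a ∈ A, ∃ c : K, V.valuation (a - algebraMap K F c) < 1 ∧
      V'.valuation (a - algebraMap K F c) < 1)
    (hV : ∀ c : K, V.valuation (algebraMap K F c) ≤ 1)
    (hV' : ∀ c : K, V'.valuation (algebraMap K F c) ≤ 1) : V = V' := by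
  have hcst : ∀ (W : ValuationSubring F), (∀ c : K, W.valuation (algebraMap K F c) ≤ 1) →
      ∀ a (c : K), W.valuation (a - algebraMap K F c) < 1 →
        W.valuation a ≤ 1 ∧ (W.valuation a < 1 ↔ c = 0) := by
    intro W hW a c hac
    have hc : c ≠ 0 → W.valuation (algebraMap K F c) = 1 := by
      intro hc
      refine le_antisymm (hW c) ?_
      have := hW c⁻¹
      rw [map_inv₀, map_inv₀] at this
      exact (inv_le_one₀ ((Valuation.pos_iff _).mpr ((map_ne_zero _).mpr hc))).mp this
    have ha : a = (a - algebraMap K F c) + algebraMap K F c := by ring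
    constructor
    · rw [ha]
      exact (W.valuation.map_add _ _).trans (max_le hac.le (hW c))
    · constructor
      · intro h1
        by_contra hc0
        have h2 : W.valuation (algebraMap K F c) < 1 := by
          rw [show algebraMap K F c = a - (a - algebraMap K F c) by ring]
          exact (W.valuation.map_sub _ _).trans_lt (max_lt h1 hac)
        exact h2.ne (hc hc0)
      · rintro rfl
        simpa using hac
  have hle : ∀ f, V.valuation f ≤ 1 → V'.valuation f ≤ 1 ∧
      (V.valuation f < 1 → V'.valuation f < 1) := by
    intro f hf
    obtain ⟨a, ha, b, hb, hb1, rfl⟩ := h f hf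
    obtain ⟨c, hc, hc'⟩ := hA a ha
    obtain ⟨d, hd, hd'⟩ := hA b hb
    have hb' : V'.valuation b = 1 := by
      refine le_antisymm (hcst V' hV' b d hd').1 (not_lt.mp fun hlt => ?_)
      exact hb1.not_lt ((hcst V hV b d hd).2.mpr ((hcst V' hV' b d hd').2.mp hlt))
    rw [map_div₀, map_div₀, hb1, hb', div_one, div_one]
    exact ⟨(hcst V' hV' a c hc').1, fun h1 =>
      (hcst V' hV' a c hc').2.mpr ((hcst V hV a c hc).2.mp h1)⟩
  ext f
  rw [← V.valuation_le_one_iff, ← V'.valuation_le_one_iff]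
  refine ⟨fun hf => (hle f hf).1, fun hf => ?_⟩
  by_contra hlt
  have hf0 : f ≠ 0 := by rintro rfl; simp at hlt
  have h1 : V.valuation f⁻¹ < 1 := by
    rw [map_inv₀]; exact inv_lt_one_of_one_lt₀ (not_le.mp hlt)
  have h2 := (hle _ h1.le).2 h1
  rw [map_inv₀] at h2
  exact absurd h2 (not_lt.mpr ((one_le_inv₀ ((Valuation.pos_iff _).mpr hf0)).mpr hf))

/-! ### The tower relations in a local ring -/

/-- In a local ring where `N` is invertible, a unit `c` is the only `N`-th root of `c ^ N` with the
same residue as `c`. -/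
theorem eq_of_pow_eq_pow_of_not_isUnit_sub {R : Type*} [CommRing R] [IsLocalRing R] {N : ℕ}
    {y c : R} (hN : IsUnit (N : R)) (hc : IsUnit c) (hyc : ¬ IsUnit (y - c))
    (h : y ^ N = c ^ N) : y = c := by
  have h0 : IsLocalRing.residue R y = IsLocalRing.residue R c := by
    rw [← sub_eq_zero, ← map_sub, IsLocalRing.residue_eq_zero_iff]
    exact hyc
  have hu : IsUnit (∑ i ∈ Finset.range N, y ^ i * c ^ (N - 1 - i)) := by
    rw [← isUnit_map_iff (IsLocalRing.residue R), isUnit_iff_ne_zero]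
    have h1 : IsLocalRing.residue R (∑ i ∈ Finset.range N, y ^ i * c ^ (N - 1 - i)) =
        IsLocalRing.residue R (N * c ^ (N - 1)) := by
      simp only [map_sum, map_mul, map_pow, h0]
      rw [geom_sum₂_self, map_natCast]
    rw [h1]
    exact ((hN.mul (hc.pow _)).map _).ne_zero
  have h2 := (Commute.all y c).geom_sum₂_mul N
  rw [h, sub_self] at h2
  exact sub_eq_zero.mp ((hu.mul_right_eq_zero).mp h2)

/-- The relations, in a ring `R`, between the generators `X i` of the tower (`i ≤ n`) and the
quotients `Z i = X (m + i) / (X (m - i) + 1)`, `1 ≤ i ≤ j`. They are stated without division so that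
they are preserved by ring homomorphisms. -/
structure TowerRelations {R : Type*} [CommRing R] (N m j n : ℕ) (X Z : ℕ → R) : Prop where
  eqn : ∀ i < n, X (i + 1) ^ N + (X i + 1) ^ N = 1
  eqn' : ∀ i < n, X (i + 1) ^ N * (1 + X i) = X i * (1 - X i ^ N)
  ratio : ∀ i, 1 ≤ i → i ≤ j → Z i * (X (m - i) + 1) = X (m + i)
  ratio_one : 1 ≤ j → Z 1 ^ N * (1 + X m) = X m
  ratio_succ : ∀ i, 1 ≤ i → i < j → Z (i + 1) ^ N * (1 + X (m + i)) * X (m - i + 1) ^ N =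
    Z i * (1 + X (m + i - 1)) ^ N * X (m - i)

theorem TowerRelations.map {R S : Type*} [CommRing R] [CommRing S] {N m j n : ℕ} {X Z : ℕ → R}
    (H : TowerRelations N m j n X Z) (ψ : R →+* S) :
    TowerRelations N m j n (fun i => ψ (X i)) (fun i => ψ (Z i)) where
  eqn i hi := by simpa using congrArg ψ (H.eqn i hi)
  eqn' i hi := by simpa using congrArg ψ (H.eqn' i hi)
  ratio i hi hj := by simpa using congrArg ψ (H.ratio i hi hj)
  ratio_one hj := by simpa using congrArg ψ (H.ratio_one hj)
  ratio_succ i hi hj := by simpa using congrArg ψ (H.ratio_succ i hi hj)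

theorem TowerRelations.of_injective {R S : Type*} [CommRing R] [CommRing S] {N m j n : ℕ}
    {X Z : ℕ → R} {x z : ℕ → S} (H : TowerRelations N m j n x z) {ι : R →+* S}
    (hι : Function.Injective ι) (hmj : j ≤ m) (hmn : m + j ≤ n)
    (hx : ∀ i ≤ n, ι (X i) = x i)
    (hz : ∀ i, 1 ≤ i → i ≤ j → ι (Z i) = z i) : TowerRelations N m j n X Z where
  eqn i hi := hι (by
    simpa [hx i (by omega), hx (i + 1) (by omega)] using H.eqn i hi)
  eqn' i hi := hι (by
    simpa [hx i (by omega), hx (i + 1) (by omega)] using H.eqn' i hi)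
  ratio i hi hj := hι (by
    simpa [hx (m - i) (by omega), hx (m + i) (by omega), hz i hi hj] using H.ratio i hi hj)
  ratio_one hj := hι (by
    simpa [hx m (by omega), hz 1 le_rfl hj] using H.ratio_one hj)
  ratio_succ i hi hj := hι (by
    simpa [hx (m - i) (by omega), hx (m + i) (by omega), hx (m - i + 1) (by omega),
      hx (m + i - 1) (by omega), hz i hi (by omega), hz (i + 1) (by omega) (by omega)]
      using H.ratio_succ i hi hj)

/-- If one of the two end elements `X 0 + 1` and `X n` vanishes, the tower relations in a local ring
force all `X i` and `Z i` to be constants, namely those prescribed as their residues. Knowledge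
propagates from `X i` to `X (i + 1)` on the left of `m`, from `X (i + 1)` to `X i` on the right of
`m`, and across `m` through `Z i * (X (m - i) + 1) = X (m + i)`. -/
theorem const_of_isLocalRing {K R : Type*} [Field K] [CommRing R] [IsLocalRing R] (χ : K →+* R)
    {N m j n : ℕ} (hN : (N : K) ≠ 0) (hev : Even N) {X Z : ℕ → R} {α : K} {c : ℕ → K}
    (hm : 1 ≤ m) (hmj : j ≤ m) (hmn : m + j ≤ n)
    (H : TowerRelations N m j n X Z)
    (hα : α ^ N = 1) (hα1 : 1 ≤ j → 1 + α ≠ 0)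
    (hc1 : 1 ≤ j → c 1 ^ N * (1 + α) = α) (hcs : ∀ i, 1 ≤ i → i < j → c (i + 1) ^ N = -c i)
    (rlt : ∀ i < m, ¬ IsUnit (X i + 1)) (rm : ¬ IsUnit (X m - χ α))
    (rgt : ∀ i, m < i → i ≤ n → ¬ IsUnit (X i))
    (rZ : ∀ i, 1 ≤ i → i ≤ j → ¬ IsUnit (Z i - χ (c i)))
    (h : X 0 + 1 = 0 ∧ n = m + j ∨ X n = 0 ∧ j = m) :
    (∀ i < m, X i = -1) ∧ X m = χ α ∧ (∀ i, m < i → i ≤ n → X i = 0) ∧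
      ∀ i, 1 ≤ i → i ≤ j → Z i = χ (c i) := by
  obtain ⟨hX, hX', hZ, hZ1, hZs⟩ := H
  have hN0 : N ≠ 0 := by rintro rfl; simp at hN
  have hNR : IsUnit (N : R) := by
    have := (isUnit_iff_ne_zero.mpr hN).map χ
    rwa [map_natCast] at this
  have hα0 : α ≠ 0 := by
    rintro rfl
    rw [zero_pow hN0] at hα
    exact zero_ne_one hα
  have hc0 : ∀ i, 1 ≤ i → i ≤ j → c i ≠ 0 := by
    intro i hi
    induction i, hi using Nat.le_induction with
    | base =>
      intro hj h0
      have := hc1 hj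
      rw [h0, zero_pow hN0, zero_mul] at this
      exact hα0 this.symm
    | succ i hi ih =>
      intro hj h0
      have := hcs i hi (by omega)
      rw [h0, zero_pow hN0, eq_comm, neg_eq_zero] at this
      exact ih (by omega) this
  have unitχ : ∀ a : K, a ≠ 0 → IsUnit (χ a) := fun a ha => (isUnit_iff_ne_zero.mpr ha).map χ
  have root : ∀ (y : R) (a : K), a ≠ 0 → ¬ IsUnit (y - χ a) → y ^ N = χ (a ^ N) → y = χ a :=
    fun y a ha hy hya => eq_of_pow_eq_pow_of_not_isUnit_sub hNR (unitχ a ha) hy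
      (by rw [hya, map_pow])
  have key : X m = χ α ∧ ((∀ i < m, X i = -1) ∧ n = m + j ∨
      (∀ i, m < i → i ≤ n → X i = 0) ∧ j = m) := by
    rcases h with ⟨h0, hn⟩ | ⟨hn, hj⟩
    · have hlt : ∀ i < m, X i = -1 := by
        intro i
        induction i with
        | zero => intro _; exact eq_neg_of_add_eq_zero_left h0
        | succ i ih =>
          intro hi
          have h1 := hX i (by omega)
          rw [ih (by omega), neg_add_cancel, zero_pow hN0, add_zero] at h1
          have h2 := root (X (i + 1)) (-1) (by simp)
            (by rw [map_neg, map_one, sub_neg_eq_add]; exact rlt _ hi)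
            (by rw [h1, hev.neg_one_pow, map_one])
          rw [h2, map_neg, map_one]
      refine ⟨?_, Or.inl ⟨hlt, hn⟩⟩
      have h1 := hX (m - 1) (by omega)
      rw [hlt (m - 1) (by omega), neg_add_cancel, zero_pow hN0, add_zero,
        Nat.sub_add_cancel hm] at h1
      exact root _ _ hα0 rm (by rw [h1, hα, map_one])
    · have hgt : ∀ d i, i + d = n → m < i → X i = 0 := by
        intro d
        induction d with
        | zero => rintro i rfl _; exact hn
        | succ d ih =>
          intro i hi hmi
          have h1 := hX' i (by omega)
          rw [ih (i + 1) (by omega) (by omega), zero_pow hN0, zero_mul] at h1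
          have h2 : IsUnit (1 - X i ^ N) := by
            rcases IsLocalRing.isUnit_or_isUnit_one_sub_self (X i ^ N) with h3 | h3
            · exact absurd ((isUnit_pow_iff hN0).mp h3) (rgt i hmi (by omega))
            · exact h3
          exact (h2.mul_left_eq_zero).mp h1.symm
      refine ⟨?_, Or.inr ⟨fun i hi hin => hgt (n - i) i (by omega) hi, hj⟩⟩
      have h1 := hX' m (by omega)
      rw [hgt (n - (m + 1)) (m + 1) (by omega) (by omega), zero_pow hN0, zero_mul] at h1
      have h2 : IsUnit (X m) := by
        by_contra h3
        refine (IsLocalRing.mem_maximalIdeal _).mp ?_ (unitχ α hα0)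
        have h4 := sub_mem ((IsLocalRing.mem_maximalIdeal _).mpr h3)
          ((IsLocalRing.mem_maximalIdeal _).mpr rm)
        rwa [sub_sub_cancel] at h4
      have h3 := (h2.mul_right_eq_zero).mp h1.symm
      exact root _ _ hα0 rm (by rw [← sub_eq_zero.mp h3, hα, map_one])
  obtain ⟨hXm, hor⟩ := key
  -- Since `Z i` is a unit, `X (m - i) + 1` and `X (m + i)` vanish together.
  have fill : ∀ i, 1 ≤ i → i ≤ j → Z i = χ (c i) → X (m - i) = -1 ∧ X (m + i) = 0 := by
    intro i hi hij hz
    have h1 := hZ i hi hij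
    rw [hz] at h1
    rcases hor with ⟨h2, -⟩ | ⟨h2, hj⟩
    · have h3 := h2 (m - i) (by omega)
      rw [h3, neg_add_cancel, mul_zero] at h1
      exact ⟨h3, h1.symm⟩
    · have h3 := h2 (m + i) (by omega) (by omega)
      rw [h3, (unitχ _ (hc0 i hi hij)).mul_right_eq_zero] at h1
      exact ⟨eq_neg_of_add_eq_zero_left h1, h3⟩
  have hZc : ∀ i, 1 ≤ i → i ≤ j → Z i = χ (c i) := by
    intro i hi
    induction i, hi using Nat.le_induction with
    | base =>
      intro hj
      refine root _ _ (hc0 1 le_rfl hj) (rZ 1 le_rfl hj) ?_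
      have h1 := hZ1 hj
      rw [hXm] at h1
      have hu : IsUnit (χ (1 + α)) := unitχ _ (hα1 hj)
      refine hu.mul_right_cancel ?_
      rw [← map_mul, hc1 hj, map_add, map_one, h1]
    | succ i hi ih =>
      intro hj
      have hz := ih (by omega)
      obtain ⟨h1, h2⟩ := fill i hi (by omega) hz
      have h3 := hZs i hi (by omega)
      have h4 : X (m - i + 1) ^ N = 1 := by
        have := hX (m - i) (by omega)
        rwa [h1, neg_add_cancel, zero_pow hN0, add_zero] at this
      have h5 : (1 + X (m + i - 1)) ^ N = 1 := by
        have := hX (m + i - 1) (by omega)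
        rwa [show m + i - 1 + 1 = m + i by omega, h2, zero_pow hN0, zero_add, add_comm] at this
      rw [h4, h5, h1, h2, hz, add_zero, mul_one, mul_one, mul_one, mul_neg_one] at h3
      refine root _ _ (hc0 _ (by omega) hj) (rZ _ (by omega) hj) ?_
      rw [h3, hcs i hi (by omega), map_neg]
  refine ⟨fun i hi => ?_, hXm, fun i hi hin => ?_, hZc⟩
  · rcases hor with ⟨h2, -⟩ | ⟨-, hj⟩
    · exact h2 i hi
    · have := (fill (m - i) (by omega) (by omega) (hZc _ (by omega) (by omega))).1
      rwa [Nat.sub_sub_self hi.le] at this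
  · rcases hor with ⟨-, hn⟩ | ⟨h2, -⟩
    · have := (fill (i - m) (by omega) (by omega) (hZc _ (by omega) (by omega))).2
      rwa [Nat.add_sub_cancel' hi.le] at this
    · exact h2 i hi hin

/-- The analogue of `const_of_isLocalRing` at the place where all the generators vanish. -/
theorem zero_of_isLocalRing {R : Type*} [CommRing R] [IsLocalRing R] {N n : ℕ} (hN0 : N ≠ 0)
    {X : ℕ → R} (hX' : ∀ i < n, X (i + 1) ^ N * (1 + X i) = X i * (1 - X i ^ N))
    (r : ∀ i ≤ n, ¬ IsUnit (X i)) (h : X n = 0) : ∀ i ≤ n, X i = 0 := by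
  have : ∀ d i, i + d = n → X i = 0 := by
    intro d
    induction d with
    | zero => rintro i rfl; exact h
    | succ d ih =>
      intro i hi
      have h1 := hX' i (by omega)
      rw [ih (i + 1) (by omega), zero_pow hN0, zero_mul] at h1
      have h2 : IsUnit (1 - X i ^ N) := by
        rcases IsLocalRing.isUnit_or_isUnit_one_sub_self (X i ^ N) with h3 | h3
        · exact absurd ((isUnit_pow_iff hN0).mp h3) (r i (by omega))
        · exact h3
      exact (h2.mul_left_eq_zero).mp h1.symm
  exact fun i hi => this (n - i) i (by omega)

/-! ### Residues determine a place -/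

/-- The part of the tower of length `n` given by a sequence in any field `F` over `K`, with `N = q -
1`. The field `F` need not be generated by the sequence. The identity `add_one_pow` replaces the
assumption that `q = N + 1` is a power of the characteristic. -/
structure IsTowerUpTo (K : Type*) {F : Type*} [Field K] [Field F] [Algebra K F] (N n : ℕ)
    (x : ℕ → F) : Prop where
  add_one_pow : ∀ a : F, (a + 1) ^ (N + 1) = a ^ (N + 1) + 1
  eqn : ∀ i < n, x (i + 1) ^ N + (x i + 1) ^ N = 1
  ne_const : ∀ i ≤ n, ∀ c : K, x i ≠ algebraMap K F c

/-- The quotient `z_i = x_{m+i} / (x_{m-i} + 1)`. For `i ≤ min m (n - m)` it is a unit at the places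
where the residue of `x_m` is not `0` or `-1`. -/
def ratio {F : Type*} [Field F] (x : ℕ → F) (m i : ℕ) : F := x (m + i) / (x (m - i) + 1)

section Field

variable {K F : Type*} [Field K] [Field F] [Algebra K F] {N n : ℕ} {x : ℕ → F}

theorem IsTowerUpTo.eqn' (H : IsTowerUpTo K N n x) {i : ℕ} (hi : i < n) :
    x (i + 1) ^ N * (1 + x i) = x i * (1 - x i ^ N) := by
  have h1 := H.eqn i hi
  have h2 := H.add_one_pow (x i)
  linear_combination (1 + x i) * h1 - h2

theorem IsTowerUpTo.eqn_symm (H : IsTowerUpTo K N n x) {i : ℕ} (hi : i < n) :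
    x (i + 1) * (x i + 1) ^ N = (x (i + 1) + 1) * (1 - (x (i + 1) + 1) ^ N) := by
  have h1 := H.eqn i hi
  have h2 := H.add_one_pow (x (i + 1))
  linear_combination x (i + 1) * h1 + h2

theorem IsTowerUpTo.add_one_ne_zero (H : IsTowerUpTo K N n x) {i : ℕ} (hi : i ≤ n) :
    x i + 1 ≠ 0 := fun h => H.ne_const i hi (-1) (by
  rw [map_neg, map_one]; exact eq_neg_of_add_eq_zero_left h)

theorem IsTowerUpTo.ne_zero (H : IsTowerUpTo K N n x) {i : ℕ} (hi : i ≤ n) : x i ≠ 0 :=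
  fun h => H.ne_const i hi 0 (by rw [map_zero]; exact h)

theorem IsTowerUpTo.relations (H : IsTowerUpTo K N n x) {m j : ℕ} (hm : 1 ≤ m) (hmj : j ≤ m)
    (hmn : m + j ≤ n) : TowerRelations N m j n x (ratio x m) := by
  have hr : ∀ i, i ≤ j → ratio x m i * (x (m - i) + 1) = x (m + i) := fun i hi =>
    div_mul_cancel₀ _ (H.add_one_ne_zero (by omega))
  refine ⟨H.eqn, fun i hi => H.eqn' hi, fun i _ hi => hr i hi, fun hj => ?_, fun i hi hij => ?_⟩
  · have h0 : (x (m - 1) + 1) ^ N ≠ 0 := pow_ne_zero _ (H.add_one_ne_zero (by omega))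
    refine mul_right_cancel₀ h0 ?_
    have h1 := H.eqn (m - 1) (by omega)
    have h2 := H.eqn' (i := m) (by omega)
    rw [Nat.sub_add_cancel hm] at h1
    have h3 := congrArg (· ^ N) (hr 1 hj)
    simp only [mul_pow] at h3
    linear_combination (1 + x m) * h3 + h2 - x m * h1
  -- Multiplying by `(x (m - (i + 1)) + 1) ^ N` clears the denominator of `ratio x m (i + 1) ^ N`.
  · have h0 : (x (m - (i + 1)) + 1) ^ N ≠ 0 := pow_ne_zero _ (H.add_one_ne_zero (by omega))
    refine mul_right_cancel₀ h0 ?_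
    have h1 := congrArg (· ^ N) (hr (i + 1) (by omega))
    simp only [mul_pow] at h1
    have h2 := hr i (by omega)
    have h3 := H.eqn' (i := m + i) (by omega)
    have h4 := H.eqn_symm (i := m - (i + 1)) (by omega)
    rw [show m - (i + 1) + 1 = m - i by omega] at h4
    have h5 := H.eqn (m - i) (by omega)
    have h6 := H.eqn (m + i - 1) (by omega)
    rw [show m + i - 1 + 1 = m + i by omega] at h6
    rw [← add_assoc] at h1
    have h6' : (1 + x (m + i - 1)) ^ N = 1 - x (m + i) ^ N := by
      rw [add_comm]; linear_combination h6
    rw [h6']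
    have h5' : x (m - i + 1) ^ N = 1 - (x (m - i) + 1) ^ N := by linear_combination h5
    rw [h5']
    linear_combination (1 + x (m + i)) * (1 - (x (m - i) + 1) ^ N) * h1 +
      (1 - (x (m - i) + 1) ^ N) * h3 - ratio x m i * (1 - x (m + i) ^ N) * h4 -
      (1 - x (m + i) ^ N) * (1 - (x (m - i) + 1) ^ N) * h2

end Field

/-- The residues at `V` of the generators `x i`, `i ≤ n`, and of the quotients `ratio x m i`, `1 ≤ i
≤ j`: they are `-1` for `i < m`, `α` for `i = m`, `0` for `i > m`, and `c i`, respectively. -/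
structure HasResidues {K F : Type*} [Field K] [Field F] [Algebra K F] (V : ValuationSubring F)
    (x : ℕ → F) (m j n : ℕ) (α : K) (c : ℕ → K) : Prop where
  const_mem : ∀ a : K, V.valuation (algebraMap K F a) ≤ 1
  of_lt : ∀ i < m, V.valuation (x i + 1) < 1
  of_eq : V.valuation (x m - algebraMap K F α) < 1
  of_gt : ∀ i, m < i → i ≤ n → V.valuation (x i) < 1
  of_ratio : ∀ i, 1 ≤ i → i ≤ j → V.valuation (ratio x m i - algebraMap K F (c i)) < 1

/-- The elements `x_0, …, x_n` together with the quotients `z_1, …, z_j`. -/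
def generators {F : Type*} [Field F] (x : ℕ → F) (m j n : ℕ) : Set F :=
  x '' Set.Iic n ∪ ratio x m '' Set.Icc 1 j

section Residues

variable {K : Type*} {F : Type u} [Field K] [Field F] [Algebra K F] {N n m j : ℕ} {x : ℕ → F}
  {V V' : ValuationSubring F} {α : K} {c : ℕ → K}

theorem exists_const_of_adjoin {G : Set F}
    (hV : ∀ a : K, V.valuation (algebraMap K F a) ≤ 1)
    (hV' : ∀ a : K, V'.valuation (algebraMap K F a) ≤ 1)
    (hG : ∀ g ∈ G, ∃ c : K, V.valuation (g - algebraMap K F c) < 1 ∧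
      V'.valuation (g - algebraMap K F c) < 1) :
    ∀ a ∈ Algebra.adjoin K G, ∃ c : K, V.valuation (a - algebraMap K F c) < 1 ∧
      V'.valuation (a - algebraMap K F c) < 1 := by
  have add : ∀ (W : ValuationSubring F) (a b : F) (c d : K),
      W.valuation (a - algebraMap K F c) < 1 → W.valuation (b - algebraMap K F d) < 1 →
      W.valuation (a + b - algebraMap K F (c + d)) < 1 := by
    intro W a b c d h1 h2
    rw [map_add, add_sub_add_comm]
    exact W.valuation.map_add_lt h1 h2
  have mul : ∀ (W : ValuationSubring F), (∀ a : K, W.valuation (algebraMap K F a) ≤ 1) →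
      ∀ (a b : F) (c d : K),
      W.valuation (a - algebraMap K F c) < 1 → W.valuation (b - algebraMap K F d) < 1 →
      W.valuation (a * b - algebraMap K F (c * d)) < 1 := by
    intro W hW a b c d h1 h2
    have hb : W.valuation b ≤ 1 := by
      rw [show b = (b - algebraMap K F d) + algebraMap K F d by ring]
      exact W.valuation.map_add_le h2.le (hW d)
    rw [map_mul, show a * b - algebraMap K F c * algebraMap K F d =
      (a - algebraMap K F c) * b + (b - algebraMap K F d) * algebraMap K F c by ring]
    refine W.valuation.map_add_lt ?_ ?_
    · rw [map_mul]; exact mul_lt_one_of_lt_of_le h1 hb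
    · rw [map_mul]; exact mul_lt_one_of_lt_of_le h2 (hW c)
  intro a ha
  induction ha using Algebra.adjoin_induction with
  | mem g hg => exact hG g hg
  | algebraMap r => exact ⟨r, by simp, by simp⟩
  | add a b _ _ h1 h2 =>
    obtain ⟨c, hc, hc'⟩ := h1
    obtain ⟨d, hd, hd'⟩ := h2
    exact ⟨c + d, add V a b c d hc hd, add V' a b c d hc' hd'⟩
  | mul a b _ _ h1 h2 =>
    obtain ⟨c, hc, hc'⟩ := h1
    obtain ⟨d, hd, hd'⟩ := h2
    exact ⟨c * d, mul V hV a b c d hc hd, mul V' hV' a b c d hc' hd'⟩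

theorem HasResidues.exists_const (R : HasResidues V x m j n α c)
    (R' : HasResidues V' x m j n α c) :
    ∀ a ∈ Algebra.adjoin K (generators x m j n), ∃ d : K,
      V.valuation (a - algebraMap K F d) < 1 ∧ V'.valuation (a - algebraMap K F d) < 1 := by
  refine exists_const_of_adjoin R.const_mem R'.const_mem ?_
  rintro g (⟨i, hi, rfl⟩ | ⟨i, hi, rfl⟩)
  · rcases lt_trichotomy i m with h | rfl | h
    · exact ⟨-1, by simpa using R.of_lt i h, by simpa using R'.of_lt i h⟩
    · exact ⟨α, R.of_eq, R'.of_eq⟩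
    · exact ⟨0, by simpa using R.of_gt i h hi, by simpa using R'.of_gt i h hi⟩
  · exact ⟨c i, R.of_ratio i hi.1 hi.2, R'.of_ratio i hi.1 hi.2⟩

theorem generators_finite : (generators x m j n).Finite :=
  ((Set.finite_Iic n).image _).union ((Set.finite_Icc 1 j).image _)

theorem exists_div_of_generators
    (hgen : ∀ f : F, ∃ a ∈ Algebra.adjoin K (x '' Set.Iic n),
      ∃ b ∈ Algebra.adjoin K (x '' Set.Iic n), f = a / b) (m j : ℕ) (f : F) :
    ∃ a ∈ Algebra.adjoin K (generators x m j n), ∃ b ∈ Algebra.adjoin K (generators x m j n),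
      f = a / b := by
  obtain ⟨a, ha, b, hb, h⟩ := hgen f
  exact ⟨a, Algebra.adjoin_mono Set.subset_union_left ha, b,
    Algebra.adjoin_mono Set.subset_union_left hb, h⟩

/-- A place with the prescribed residues is the local ring of `K[x_0, …, x_n, z_1, …, z_j]` at its
center, and is rational. The uniformizer is `x_0 + 1` if `m + j = n`, and `x_n` if `j = m`. -/
theorem HasResidues.valuationSubring_of_adjoin (R : HasResidues V x m j n α c)
    (H : IsTowerUpTo K N n x)
    (hgen : ∀ f : F, ∃ a ∈ Algebra.adjoin K (x '' Set.Iic n),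
      ∃ b ∈ Algebra.adjoin K (x '' Set.Iic n), f = a / b)
    (hN : (N : K) ≠ 0) (hev : Even N) (hm : 1 ≤ m) (hmn : m ≤ n)
    (hj : j = min m (n - m)) (hα : α ^ N = 1) (hα1 : 1 ≤ j → 1 + α ≠ 0)
    (hc1 : 1 ≤ j → c 1 ^ N * (1 + α) = α) (hcs : ∀ i, 1 ≤ i → i < j → c (i + 1) ^ N = -c i) :
    (∀ f, V.valuation f ≤ 1 → ∃ a ∈ Algebra.adjoin K (generators x m j n),
      ∃ b ∈ Algebra.adjoin K (generators x m j n), V.valuation b = 1 ∧ f = a / b) ∧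
    (∀ f, V.valuation f ≤ 1 → ∃ c : K, V.valuation (f - algebraMap K F c) < 1) := by
  classical
  have hN0 : N ≠ 0 := by rintro rfl; simp at hN
  let A := Algebra.adjoin K (generators x m j n)
  have hxA : ∀ i ≤ n, x i ∈ A := fun i hi =>
    Algebra.subset_adjoin (Or.inl ⟨i, hi, rfl⟩)
  have hzA : ∀ i, 1 ≤ i → i ≤ j → ratio x m i ∈ A := fun i hi hj =>
    Algebra.subset_adjoin (Or.inr ⟨i, ⟨hi, hj⟩, rfl⟩)
  let X : ℕ → A := fun i => if h : i ≤ n then ⟨x i, hxA i h⟩ else 0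
  let Z : ℕ → A := fun i => if h : 1 ≤ i ∧ i ≤ j then ⟨ratio x m i, hzA i h.1 h.2⟩ else 0
  have hX : ∀ i (h : i ≤ n), X i = ⟨x i, hxA i h⟩ := fun i h => dif_pos h
  have hZ : ∀ i (h1 : 1 ≤ i) (h2 : i ≤ j), Z i = ⟨ratio x m i, hzA i h1 h2⟩ := fun i h1 h2 =>
    dif_pos ⟨h1, h2⟩
  have hXv : ∀ i, i ≤ n → (X i : F) = x i := fun i h => by rw [hX i h]
  have hZv : ∀ i, 1 ≤ i → i ≤ j → (Z i : F) = ratio x m i := fun i h h' => by rw [hZ i h h']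
  have rel : TowerRelations N m j n X Z :=
    (H.relations hm (by omega) (by omega)).of_injective (ι := A.val.toRingHom)
      Subtype.val_injective (by omega) (by omega) hXv hZv
  let t : A := if n = m + j then X 0 + 1 else X n
  have ht : V.valuation (t : F) < 1 := by
    by_cases h : n = m + j
    · have : (t : F) = x 0 + 1 := by simp [t, h, ← hXv 0]
      rw [this]
      exact R.of_lt 0 hm
    · have : (t : F) = x n := by simp [t, h, ← hXv n]
      rw [this]
      exact R.of_gt n (by omega) le_rfl
  have hA : ∀ a ∈ A, V.valuation a ≤ 1 := by
    intro a ha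
    obtain ⟨d, hd, -⟩ := R.exists_const R a ha
    rw [show a = (a - algebraMap K F d) + algebraMap K F d by ring]
    exact V.valuation.map_add_le hd.le (R.const_mem d)
  have main := KummerTower.valuationSubring_of_adjoin generators_finite
    (exists_div_of_generators hgen m j) V hA t ht
    (by
      intro S _ _ ψ hψ hψt
      have nu : ∀ a : A, V.valuation (a : F) < 1 → ¬ IsUnit (ψ a) := fun a ha hu =>
        ha.ne ((hψ a).mp hu)
      have := const_of_isLocalRing (ψ.comp (algebraMap K A)) (α := α) (c := c) hN hev hm
        (by omega) (by omega) (rel.map ψ) hα hα1 hc1 hcs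
        (fun i hi => by
          rw [← map_one ψ, ← map_add]
          exact nu _ (by simpa [hXv i (by omega)] using R.of_lt i hi))
        (by
          rw [RingHom.comp_apply, ← map_sub]
          exact nu _ (by simpa [hXv m hmn] using R.of_eq))
        (fun i hi hin => nu _ (by simpa [hXv i hin] using R.of_gt i hi hin))
        (fun i hi hij => by
          rw [RingHom.comp_apply, ← map_sub]
          exact nu _ (by simpa [hZv i hi hij] using R.of_ratio i hi hij))
        (by
          by_cases h : n = m + j
          · refine Or.inl ⟨?_, h⟩
            rw [← map_one ψ, ← map_add, ← hψt]
            simp [t, h]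
          · refine Or.inr ⟨?_, by omega⟩
            rw [← hψt]
            simp [t, h])
      obtain ⟨hlt, heq, hgt, hz⟩ := this
      rintro g (⟨i, hi, rfl⟩ | ⟨i, hi, rfl⟩)
      · change ∃ c, ψ (⟨x i, hxA i hi⟩ : A) = _
        rw [← hX i hi]
        rcases lt_trichotomy i m with h | rfl | h
        · exact ⟨-1, by rw [hlt i h]; simp⟩
        · exact ⟨α, heq⟩
        · exact ⟨0, by rw [hgt i h hi]; simp⟩
      · change ∃ c, ψ (⟨ratio x m i, hzA i hi.1 hi.2⟩ : A) = _
        rw [← hZ i hi.1 hi.2]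
        exact ⟨c i, hz i hi.1 hi.2⟩)
  exact ⟨main.1, main.2.2⟩

theorem HasResidues.unique (R : HasResidues V x m j n α c) (R' : HasResidues V' x m j n α c)
    (H : IsTowerUpTo K N n x)
    (hgen : ∀ f : F, ∃ a ∈ Algebra.adjoin K (x '' Set.Iic n),
      ∃ b ∈ Algebra.adjoin K (x '' Set.Iic n), f = a / b)
    (hN : (N : K) ≠ 0) (hev : Even N) (hm : 1 ≤ m) (hmn : m ≤ n)
    (hj : j = min m (n - m)) (hα : α ^ N = 1) (hα1 : 1 ≤ j → 1 + α ≠ 0)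
    (hc1 : 1 ≤ j → c 1 ^ N * (1 + α) = α) (hcs : ∀ i, 1 ≤ i → i < j → c (i + 1) ^ N = -c i) :
    V = V' :=
  valuationSubring_eq_of_adjoin
    (R.valuationSubring_of_adjoin H hgen hN hev hm hmn hj hα hα1 hc1 hcs).1
    (R.exists_const R') R.const_mem R'.const_mem

/-- At a place where all generators vanish, the last one, `x n`, is a uniformizer. -/
theorem exists_uniformizer_of_zero (H : IsTowerUpTo K N n x)
    (hgen : ∀ f : F, ∃ a ∈ Algebra.adjoin K (x '' Set.Iic n),
      ∃ b ∈ Algebra.adjoin K (x '' Set.Iic n), f = a / b)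
    (hN0 : N ≠ 0)
    (hV : ∀ a : K, V.valuation (algebraMap K F a) ≤ 1) (h : ∀ i ≤ n, V.valuation (x i) < 1) :
    ∀ f, V.valuation f < 1 → ∃ u, V.valuation u ≤ 1 ∧ f = x n * u := by
  let A := Algebra.adjoin K (x '' Set.Iic n)
  have hxA : ∀ i ≤ n, x i ∈ A := fun i hi => Algebra.subset_adjoin ⟨i, hi, rfl⟩
  let X : ℕ → A := fun i => if h : i ≤ n then ⟨x i, hxA i h⟩ else 0
  have hX : ∀ i (h : i ≤ n), X i = ⟨x i, hxA i h⟩ := fun i h => dif_pos h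
  have hXv : ∀ i, i ≤ n → (X i : F) = x i := fun i h => by rw [hX i h]
  have hA : ∀ a ∈ A, V.valuation a ≤ 1 := by
    intro a ha
    obtain ⟨d, hd, -⟩ := exists_const_of_adjoin (G := x '' Set.Iic n) hV hV (by
      rintro g ⟨i, hi, rfl⟩
      exact ⟨0, by simpa using h i hi, by simpa using h i hi⟩) a ha
    rw [show a = (a - algebraMap K F d) + algebraMap K F d by ring]
    exact V.valuation.map_add_le hd.le (hV d)
  have main := KummerTower.valuationSubring_of_adjoin ((Set.finite_Iic n).image x)
    hgen V hA (X n) (by rw [hXv n le_rfl]; exact h n le_rfl)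
    (by
      intro S _ _ ψ hψ hψt
      have := zero_of_isLocalRing (N := N) (n := n) (X := fun i => ψ (X i)) hN0
        (fun i hi => by
          have h1 : X (i + 1) ^ N * (1 + X i) = X i * (1 - X i ^ N) := by
            apply Subtype.ext
            simpa [hXv i (by omega), hXv (i + 1) (by omega)] using H.eqn' hi
          simpa using congrArg ψ h1)
        (fun i hi hu => by
          have := (hψ _).mp hu
          rw [hXv i hi] at this
          exact (h i hi).ne this) hψt
      rintro g ⟨i, hi, rfl⟩
      change ∃ c, ψ (⟨x i, hxA i hi⟩ : A) = _
      rw [← hX i hi]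
      exact ⟨0, by simpa using this i hi⟩)
  intro f hf
  obtain ⟨u, hu, hfu⟩ := main.2.1 f hf
  exact ⟨u, hu, by rw [hfu, hXv n le_rfl]⟩

end Residues

/-! ### Residues forced by the tower equations -/

section Valuation

variable {K F : Type*} [Field K] [Field F] [Algebra K F] {V : ValuationSubring F}

theorem valuation_pow_sub_pow_lt {a b : F} (ha : V.valuation a ≤ 1) (hb : V.valuation b ≤ 1)
    (h : V.valuation (a - b) < 1) (N : ℕ) : V.valuation (a ^ N - b ^ N) < 1 := by
  obtain ⟨w, hw⟩ := sub_dvd_pow_sub_pow (⟨a, V.mem_of_valuation_le_one a ha⟩ : V)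
    ⟨b, V.mem_of_valuation_le_one b hb⟩ N
  have h1 : a ^ N - b ^ N = (a - b) * w := congrArg Subtype.val hw
  rw [h1, map_mul]
  exact mul_lt_one_of_lt_of_le h (V.valuation_le_one w)

theorem valuation_algebraMap_eq_one (hV : ∀ a : K, V.valuation (algebraMap K F a) ≤ 1) {d : K}
    (hd : d ≠ 0) : V.valuation (algebraMap K F d) = 1 := by
  refine le_antisymm (hV d) ?_
  have := hV d⁻¹
  rw [map_inv₀, map_inv₀] at this
  exact (inv_le_one₀ ((Valuation.pos_iff _).mpr ((map_ne_zero _).mpr hd))).mp this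

theorem valuation_eq_one_of_sub_lt (hV : ∀ a : K, V.valuation (algebraMap K F a) ≤ 1) {a : F}
    {d : K} (hd : d ≠ 0) (h : V.valuation (a - algebraMap K F d) < 1) : V.valuation a = 1 := by
  have h1 := valuation_algebraMap_eq_one hV hd
  rw [← h1]
  exact Valuation.map_eq_of_sub_lt _ (by rwa [h1])

theorem valuation_le_one_of_sub_lt (hV : ∀ a : K, V.valuation (algebraMap K F a) ≤ 1) {a : F}
    {d : K} (h : V.valuation (a - algebraMap K F d) < 1) : V.valuation a ≤ 1 := by
  rw [show a = (a - algebraMap K F d) + algebraMap K F d by ring]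
  exact V.valuation.map_add_le h.le (hV d)

theorem eq_of_valuation_sub_lt (hV : ∀ a : K, V.valuation (algebraMap K F a) ≤ 1) {a : F}
    {c d : K} (hc : V.valuation (a - algebraMap K F c) < 1)
    (hd : V.valuation (a - algebraMap K F d) < 1) : c = d := by
  by_contra hne
  have h1 := valuation_algebraMap_eq_one hV (sub_ne_zero.mpr hne)
  rw [map_sub, show algebraMap K F c - algebraMap K F d =
    (a - algebraMap K F d) - (a - algebraMap K F c) by ring] at h1
  exact (V.valuation.map_sub_lt hd hc).ne h1

theorem valuation_lt_one_of_pow {a : F} {N : ℕ} (hN : N ≠ 0) (h : V.valuation (a ^ N) < 1) :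
    V.valuation a < 1 := by
  rw [map_pow] at h
  exact (pow_lt_one_iff hN).mp h

end Valuation

section Field

variable {K F : Type*} [Field K] [Field F] [Algebra K F] {N n m j : ℕ} {x : ℕ → F}
  {V : ValuationSubring F} {α : K}

theorem valuation_add_one_lt_of_valuation_sub_lt (H : IsTowerUpTo K N n x) (hN0 : N ≠ 0)
    (hev : Even N) (hV : ∀ a : K, V.valuation (algebraMap K F a) ≤ 1) (hmn : m ≤ n)
    (hα : α ^ N = 1) (hm : V.valuation (x m - algebraMap K F α) < 1) :
    ∀ i < m, V.valuation (x i + 1) < 1 := by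
  have step : ∀ i < n, ∀ β : K, β ^ N = 1 → V.valuation (x (i + 1) - algebraMap K F β) < 1 →
      V.valuation (x i + 1) < 1 := by
    intro i hi β hβ h
    refine valuation_lt_one_of_pow hN0 ?_
    have h1 := valuation_pow_sub_pow_lt (valuation_le_one_of_sub_lt hV h) (hV β) h N
    rw [← map_pow, hβ, map_one] at h1
    rw [← Valuation.map_neg] at h1
    convert h1 using 2
    linear_combination H.eqn i hi
  have : ∀ d i, i + d + 1 = m → V.valuation (x i + 1) < 1 := by
    intro d
    induction d with
    | zero =>
      rintro i rfl
      exact step i (by omega) α hα hm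
    | succ d ih =>
      intro i hi
      refine step i (by omega) (-1) hev.neg_one_pow ?_
      simpa using ih (i + 1) (by omega)
  exact fun i hi => this (m - i - 1) i (by omega)

theorem valuation_lt_of_valuation_sub_lt (H : IsTowerUpTo K N n x) (hN0 : N ≠ 0)
    (hV : ∀ a : K, V.valuation (algebraMap K F a) ≤ 1)
    (hα : (1 + α) ^ N = 1) (hm : V.valuation (x m - algebraMap K F α) < 1) :
    ∀ i, m < i → i ≤ n → V.valuation (x i) < 1 := by
  have step : ∀ i < n, ∀ β : K, (1 + β) ^ N = 1 → V.valuation (x i - algebraMap K F β) < 1 →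
      V.valuation (x (i + 1)) < 1 := by
    intro i hi β hβ h
    refine valuation_lt_one_of_pow hN0 ?_
    have h0 : V.valuation ((x i + 1) - algebraMap K F (1 + β)) < 1 := by
      rw [map_add, map_one]
      convert h using 2
      ring
    have h1 := valuation_pow_sub_pow_lt (valuation_le_one_of_sub_lt hV h0) (hV _) h0 N
    rw [← map_pow, hβ, map_one] at h1
    rw [← Valuation.map_neg] at h1
    convert h1 using 2
    linear_combination H.eqn i hi
  intro i hi
  induction i, hi using Nat.le_induction with
  | base => exact fun hin => step m (by omega) α hα hm
  | succ i hi ih => exact fun hin => step i (by omega) 0 (by simp) (by simpa using ih (by omega))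

/-- Where `x_m` has a residue `α ∈ 𝔽_q` other than `0` and `-1`, the quotients `z_i` are units, with
`z_1 ^ N ≡ α / (1 + α)` and `z_{i+1} ^ N ≡ -z_i`. -/
theorem valuation_ratio (H : IsTowerUpTo K N n x) (hN0 : N ≠ 0)
    (hev : Even N) (hV : ∀ a : K, V.valuation (algebraMap K F a) ≤ 1) (h1m : 1 ≤ m) (hjm : j ≤ m)
    (hmn : m + j ≤ n) (hα : α ^ N = 1) (hα' : (1 + α) ^ N = 1)
    (hm : V.valuation (x m - algebraMap K F α) < 1) :
    (∀ i, 1 ≤ i → i ≤ j → V.valuation (ratio x m i) = 1) ∧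
    (1 ≤ j → V.valuation (ratio x m 1 ^ N - algebraMap K F (α / (1 + α))) < 1) ∧
    (∀ i, 1 ≤ i → i < j → V.valuation (ratio x m (i + 1) ^ N + ratio x m i) < 1) := by
  have hlt := valuation_add_one_lt_of_valuation_sub_lt H hN0 hev hV (by omega) hα hm
  have hgt := valuation_lt_of_valuation_sub_lt H hN0 hV hα' hm
  have rel := H.relations h1m hjm hmn
  have ne0 : ∀ β : K, β ^ N = 1 → β ≠ 0 := by
    rintro β hβ rfl
    rw [zero_pow hN0] at hβ
    exact zero_ne_one hβ
  have hm1 : V.valuation (1 + x m - algebraMap K F (1 + α)) < 1 := by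
    rw [map_add, map_one]
    convert hm using 2
    ring
  have vm : V.valuation (x m) = 1 := valuation_eq_one_of_sub_lt hV (ne0 _ hα) hm
  have vm1 : V.valuation (1 + x m) = 1 := valuation_eq_one_of_sub_lt hV (ne0 _ hα') hm1
  have vlt : ∀ i < m, V.valuation (x i) = 1 := fun i hi =>
    valuation_eq_one_of_sub_lt hV (d := -1) (by simp) (by simpa using hlt i hi)
  have vgt : ∀ i, m ≤ i → i ≤ n → V.valuation (1 + x i) = 1 := by
    intro i hi hin
    rcases hi.eq_or_lt with rfl | h
    · exact vm1
    · exact V.valuation.map_one_add_of_lt (hgt i h hin)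
  have one_of_pow : ∀ f : F, V.valuation f ^ N = 1 → V.valuation f = 1 := fun f hf =>
    (pow_eq_one_iff.mp hf).resolve_right hN0
  have hz : ∀ i, 1 ≤ i → i ≤ j → V.valuation (ratio x m i) = 1 := by
    intro i hi
    induction i, hi using Nat.le_induction with
    | base =>
      intro hj
      have h1 := congrArg V.valuation (rel.ratio_one hj)
      rw [map_mul, map_pow, vm, vm1, mul_one] at h1
      exact one_of_pow _ h1
    | succ i hi ih =>
      intro hj
      have h1 := congrArg V.valuation (rel.ratio_succ i hi (by omega))
      have h2 : V.valuation (x (m - i + 1)) = 1 := by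
        rcases hi.eq_or_lt with rfl | h
        · rwa [Nat.sub_add_cancel h1m]
        · exact vlt _ (by omega)
      simp only [map_mul, map_pow] at h1
      rw [vgt (m + i) (by omega) (by omega), h2, vgt (m + i - 1) (by omega) (by omega),
        vlt (m - i) (by omega), ih (by omega), one_pow, mul_one, mul_one, mul_one, mul_one] at h1
      exact one_of_pow _ h1
  refine ⟨hz, fun hj => ?_, fun i hi hij => ?_⟩
  · have h0 : algebraMap K F (1 + α) ≠ 0 := (map_ne_zero _).mpr (ne0 _ hα')
    have h1 := rel.ratio_one hj
    have h2 : ratio x m 1 ^ N - algebraMap K F (α / (1 + α)) =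
        (x m - algebraMap K F α) * ((1 - ratio x m 1 ^ N) * (algebraMap K F (1 + α))⁻¹) := by
      rw [map_div₀]
      field_simp
      rw [map_add, map_one]
      linear_combination h1
    rw [h2, map_mul]
    refine mul_lt_one_of_lt_of_le hm ?_
    rw [map_mul, map_inv₀, valuation_algebraMap_eq_one hV (ne0 _ hα'), inv_one, mul_one]
    exact V.valuation.map_sub_le (by simp) (by simp [hz 1 le_rfl hj])
  · have h1 := rel.ratio_succ i hi hij
    have h2 := H.eqn (m - i) (by omega)
    have h3 := H.eqn (m + i - 1) (by omega)
    rw [show m + i - 1 + 1 = m + i by omega] at h3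
    obtain ⟨M, rfl⟩ : ∃ M, N = M + 1 := ⟨N - 1, by omega⟩
    have hp := hgt (m + i) (by omega) (by omega)
    have hu := hlt (m - i) (by omega)
    set p := x (m + i)
    set u := x (m - i) + 1 with hu'
    set z' := ratio x m (i + 1) ^ (M + 1) with hz'
    set z := ratio x m i with hzdef
    -- Both `p` and `u` have residue zero, and the cofactors are integral.
    have key : z' + z = p * (z * p ^ M - z * u * p ^ M - z') +
        u * (z + z' * u ^ M + z' * p * u ^ M) := by
      have e2 : x (m - i + 1) ^ (M + 1) = 1 - u ^ (M + 1) := by linear_combination h2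
      have e3 : (1 + x (m + i - 1)) ^ (M + 1) = 1 - p ^ (M + 1) := by
        rw [add_comm]; linear_combination h3
      rw [e2, e3, show x (m - i) = u - 1 by rw [hu']; ring] at h1
      linear_combination h1
    have mz : z ∈ V := (V.valuation_le_one_iff _).mp (hz i hi hij.le).le
    have mz' : z' ∈ V := V.toSubring.pow_mem
      ((V.valuation_le_one_iff _).mp (hz (i + 1) (by omega) hij).le) _
    have mp : p ∈ V := (V.valuation_le_one_iff _).mp hp.le
    have mu : u ∈ V := (V.valuation_le_one_iff _).mp hu.le
    have mpM : p ^ M ∈ V := V.toSubring.pow_mem mp _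
    have muM : u ^ M ∈ V := V.toSubring.pow_mem mu _
    rw [key]
    refine V.valuation.map_add_lt ?_ ?_
    · rw [map_mul]
      refine mul_lt_one_of_lt_of_le hp ((V.valuation_le_one_iff _).mpr ?_)
      exact sub_mem (sub_mem (mul_mem mz mpM) (mul_mem (mul_mem mz mu) mpM)) mz'
    · rw [map_mul]
      refine mul_lt_one_of_lt_of_le hu ((V.valuation_le_one_iff _).mpr ?_)
      exact add_mem (add_mem mz (mul_mem mz' muM)) (mul_mem (mul_mem mz' mp) muM)

/-- The residues of `z_1, …, z_j` when the last one is `c`: solving `c_{i+1} ^ N = -c_i` downwards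
with `N` even gives `c_i = -c ^ (N ^ (j - i))` for `i < j`. The value at `0` is not used as a
residue. -/
def chain (N j : ℕ) (c : K) (i : ℕ) : K := if i < j then -c ^ N ^ (j - i) else c

theorem chain_succ_pow (hev : Even N) {i : ℕ} (hij : i < j) (c : K) :
    chain N j c (i + 1) ^ N = -chain N j c i := by
  have h : N ^ (j - i) = N ^ (j - (i + 1)) * N := by
    rw [← pow_succ]
    congr 1
    omega
  unfold chain
  rw [if_pos hij, neg_neg, h, pow_mul]
  split_ifs with h1
  · rw [hev.neg_pow]
  · rw [show j - (i + 1) = 0 by omega, pow_zero, pow_one]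

theorem chain_one_pow (hev : Even N) (hj : 1 ≤ j) (c : K) :
    chain N j c 1 ^ N = c ^ N ^ j := by
  have := chain_succ_pow hev (i := 0) hj c
  rwa [show chain N j c 0 = -c ^ N ^ j from if_pos hj, neg_neg] at this

theorem chain_self (c : K) : chain N j c j = c := if_neg (lt_irrefl j)

/-- All the residues are determined by the residue `α` of `x_m` and the residue `c` of `z_j`, and
these are related by `c ^ (N ^ j) = α / (1 + α)`. If `m = n`, then `j = 0`, and `α = -1` is allowed.
-/
theorem hasResidues_of_valuation_sub_lt (H : IsTowerUpTo K N n x) (hN0 : N ≠ 0)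
    (hev : Even N) (hV : ∀ a : K, V.valuation (algebraMap K F a) ≤ 1) (h1m : 1 ≤ m) (hmn : m ≤ n)
    (hj : j = min m (n - m)) (hα : α ^ N = 1) (hα' : m < n → (1 + α) ^ N = 1)
    (hm : V.valuation (x m - algebraMap K F α) < 1) (c : K)
    (hc : 1 ≤ j → V.valuation (ratio x m j - algebraMap K F c) < 1) :
    HasResidues V x m j n α (chain N j c) ∧ (1 ≤ j → c ^ N ^ j = α / (1 + α)) := by
  have hrat : ∀ d i, i + d = j → 1 ≤ i →
      V.valuation (ratio x m i - algebraMap K F (chain N j c i)) < 1 := by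
    intro d
    induction d with
    | zero =>
      intro i hi h1
      obtain rfl : i = j := hi
      rw [chain_self]
      exact hc h1
    | succ d ih =>
      intro i hi h1
      have h2 := ih (i + 1) (by omega) (by omega)
      have h3 := valuation_pow_sub_pow_lt (valuation_le_one_of_sub_lt hV h2) (hV _) h2 N
      rw [← map_pow, chain_succ_pow hev (by omega), map_neg, sub_neg_eq_add] at h3
      have h4 := (valuation_ratio H hN0 hev hV h1m (by omega : j ≤ m) (by omega) hα
        (hα' (by omega)) hm).2.2 i h1 (by omega)
      convert V.valuation.map_sub_lt h4 h3 using 2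
      ring
  refine ⟨⟨hV, valuation_add_one_lt_of_valuation_sub_lt H hN0 hev hV hmn hα hm, hm, fun i hi hin =>
    valuation_lt_of_valuation_sub_lt H hN0 hV (hα' (by omega)) hm i hi hin,
    fun i hi hij => hrat (j - i) i (by omega) hi⟩, fun h1 => ?_⟩
  have h2 := hrat (j - 1) 1 (by omega) le_rfl
  have h3 := valuation_pow_sub_pow_lt (valuation_le_one_of_sub_lt hV h2) (hV _) h2 N
  rw [← map_pow, chain_one_pow hev h1] at h3
  exact eq_of_valuation_sub_lt hV h3 ((valuation_ratio H hN0 hev hV h1m (by omega : j ≤ m)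
    (by omega) hα (hα' (by omega)) hm).2.1 h1)

end Field

/-! ### Existence of places with prescribed residues -/

section

open Polynomial

section Existence

variable {K Ω : Type*} [Field K] [Field Ω] [Algebra K Ω] {N : ℕ} {x : ℕ → Ω}

theorem IsTowerSequence.transcendental_apply (hx : IsTowerSequence K (N + 1) x) (hN0 : N ≠ 0)
    (i : ℕ) : Transcendental K (x i) := by
  induction i with
  | zero => exact hx.transcendental
  | succ i ih =>
    intro h
    have h1 : IsAlgebraic K ((x i + 1) ^ N) := by
      have h2 := hx.equation i
      rw [Nat.add_sub_cancel] at h2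
      rw [eq_sub_of_add_eq' h2]
      exact isAlgebraic_one.sub (h.pow N)
    have h2 := (h1.of_pow (Nat.pos_of_ne_zero hN0)).sub isAlgebraic_one
    rw [add_sub_cancel_right] at h2
    exact ih h2

theorem IsTowerSequence.isTowerUpTo (hx : IsTowerSequence K (N + 1) x) (hN0 : N ≠ 0)
    (hfrob : ∀ a : Ω, (a + 1) ^ (N + 1) = a ^ (N + 1) + 1) (n : ℕ) : IsTowerUpTo K N n x where
  add_one_pow := hfrob
  eqn i _ := hx.equation i
  ne_const i _ c h := hx.transcendental_apply hN0 i (h ▸ isAlgebraic_algebraMap c)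

variable (K x) in
/-- The generators of `F_n` as a sequence in `F_n`, with the value `0` beyond the index `n`. -/
def levelSeq (n i : ℕ) : level K x n := if h : i ≤ n then gen K x h else 0

theorem coe_levelSeq {n i : ℕ} (h : i ≤ n) : (levelSeq K x n i : Ω) = x i := by
  rw [levelSeq, dif_pos h]
  rfl

theorem coe_ratio_levelSeq {n m i : ℕ} (h : m + i ≤ n) :
    ((ratio (levelSeq K x n) m i : level K x n) : Ω) = ratio x m i := by
  rw [ratio, ratio, ← coe_levelSeq (K := K) (x := x) (n := n) (i := m + i) h,
    ← coe_levelSeq (K := K) (x := x) (n := n) (i := m - i) (by omega)]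
  simp

theorem IsTowerSequence.isTowerUpTo_levelSeq (hx : IsTowerSequence K (N + 1) x) (hN0 : N ≠ 0)
    (hfrob : ∀ a : Ω, (a + 1) ^ (N + 1) = a ^ (N + 1) + 1) (n : ℕ) :
    IsTowerUpTo K N n (levelSeq K x n) where
  add_one_pow a := Subtype.ext (hfrob a)
  eqn i hi := Subtype.ext (by
    simpa [coe_levelSeq (K := K) (x := x) hi.le, coe_levelSeq (K := K) (x := x) (n := n) hi]
      using hx.equation i)
  ne_const i hi c h := (hx.isTowerUpTo hN0 hfrob n).ne_const i hi c (by
    rw [← coe_levelSeq (K := K) (x := x) hi, h]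
    rfl)

theorem exists_div_of_level (n : ℕ) (f : level K x n) :
    ∃ a ∈ Algebra.adjoin K (levelSeq K x n '' Set.Iic n),
      ∃ b ∈ Algebra.adjoin K (levelSeq K x n '' Set.Iic n), f = a / b := by
  have hmap : (Algebra.adjoin K (levelSeq K x n '' Set.Iic n)).map (level K x n).val =
      Algebra.adjoin K (x '' Set.Iic n) := by
    rw [AlgHom.map_adjoin, Set.image_image]
    congr 1
    exact Set.image_congr fun i hi => coe_levelSeq hi
  obtain ⟨a, ha, b, hb, hf⟩ := IntermediateField.mem_adjoin_iff_div.mp f.2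
  rw [← hmap] at ha hb
  obtain ⟨a, ha, rfl⟩ := ha
  obtain ⟨b, hb, rfl⟩ := hb
  exact ⟨a, ha, b, hb, Subtype.ext hf⟩

theorem exists_valuationSubring_of_transcendental {y : Ω} (hy : Transcendental K y) :
    ∃ V : ValuationSubring Ω, (∀ a : K, V.valuation (algebraMap K Ω a) ≤ 1) ∧
      V.valuation y < 1 := by
  obtain ⟨V, hV⟩ := exists_valuationSubring_of_ker_le (aeval y : K[X] →ₐ[K] Ω).toRingHom
    (evalRingHom (0 : K)) (by
      intro P hP
      have : P = 0 := transcendental_iff_injective.mp hy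
        ((RingHom.mem_ker.mp hP).trans (map_zero (aeval y)).symm)
      rw [this]
      exact zero_mem _)
  refine ⟨V, fun a => by simpa using (hV (C a)).1, by simpa using (hV X).2 (by simp)⟩

theorem valuation_comap_le_one {E : Type*} [Field E] (V : ValuationSubring Ω) (φ : E →+* Ω)
    (f : E) : (V.comap φ).valuation f ≤ 1 ↔ V.valuation (φ f) ≤ 1 := by
  rw [ValuationSubring.valuation_le_one_iff, ValuationSubring.valuation_le_one_iff]
  rfl

theorem valuation_comap_lt_one {E : Type*} [Field E] (V : ValuationSubring Ω) (φ : E →+* Ω)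
    (f : E) : (V.comap φ).valuation f < 1 ↔ V.valuation (φ f) < 1 := by
  rw [← ValuationSubring.mem_nonunits_iff, ← ValuationSubring.mem_nonunits_iff,
    ValuationSubring.mem_nonunits_iff_or, ValuationSubring.mem_nonunits_iff_or, ← map_inv₀,
    map_eq_zero]
  rfl

/-- Eisenstein's criterion for `X ^ N - a` over a field `E`, at a valuation ring whose maximal ideal
is generated by `t`, with `a` a unit times `t`. -/
theorem irreducible_X_pow_sub_C_of_uniformizer {E : Type*} [Field E] (V : ValuationSubring E)
    {t a u : E} (ht : V.valuation t < 1) (ht0 : t ≠ 0)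
    (hmax : ∀ f, V.valuation f < 1 → ∃ w, V.valuation w ≤ 1 ∧ f = t * w)
    (hu : V.valuation u = 1) (ha : a = t * u) {N : ℕ} (hN0 : N ≠ 0) :
    Irreducible (X ^ N - C a : E[X]) := by
  have hav : V.valuation a < 1 := by
    rw [ha, map_mul, hu, mul_one]; exact ht
  let a' : V := ⟨a, V.mem_of_valuation_le_one a hav.le⟩
  let t' : V := ⟨t, V.mem_of_valuation_le_one t ht.le⟩
  have hP : IsLocalRing.maximalIdeal V = Ideal.span {t'} := by
    apply le_antisymm
    · intro f hf
      obtain ⟨w, hw, hfw⟩ := hmax f ((V.valuation_lt_one_iff f).mp hf)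
      exact Ideal.mem_span_singleton'.mpr ⟨⟨w, V.mem_of_valuation_le_one w hw⟩,
        Subtype.ext (by rw [hfw, mul_comm]; rfl)⟩
    · rw [Ideal.span_singleton_le_iff_mem]
      exact (V.valuation_lt_one_iff t').mpr ht
  have hmon : (X ^ N - C a' : V[X]).Monic := monic_X_pow_sub_C a' hN0
  have hdeg : (X ^ N - C a' : V[X]).degree = N := degree_X_pow_sub_C (Nat.pos_of_ne_zero hN0) a'
  have hirr : Irreducible (X ^ N - C a' : V[X]) := by
    refine irreducible_of_eisenstein_criterion
      (IsLocalRing.maximalIdeal.isMaximal V).isPrime ?_ ?_ ?_ ?_ hmon.isPrimitive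
    · rw [hmon.leadingCoeff]
      exact (Ideal.ne_top_iff_one _).mp (IsLocalRing.maximalIdeal.isMaximal V).ne_top
    · intro i hi
      rw [hdeg, Nat.cast_lt] at hi
      rw [coeff_sub, coeff_X_pow, if_neg hi.ne, zero_sub, neg_mem_iff, coeff_C]
      split_ifs
      · exact (V.valuation_lt_one_iff a').mpr hav
      · exact zero_mem _
    · rw [hdeg]
      exact_mod_cast Nat.pos_of_ne_zero hN0
    · rw [coeff_sub, coeff_X_pow, if_neg (Ne.symm hN0), zero_sub, neg_mem_iff, coeff_C_zero, hP,
        Ideal.span_singleton_pow, Ideal.mem_span_singleton']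
      rintro ⟨w, hw⟩
      have h1 : (w : E) * t ^ 2 = a := congrArg Subtype.val hw
      have h2 : t * w = u := mul_left_cancel₀ ht0 (by rw [← ha, ← h1]; ring)
      rw [← h2, map_mul] at hu
      exact (mul_lt_one_of_lt_of_le ht (V.valuation_le_one w)).ne hu
  have := (hmon.irreducible_iff_irreducible_map_fraction_map (K := E)).mp hirr
  rwa [Polynomial.map_sub, Polynomial.map_pow, map_X, map_C] at this

theorem exists_valuationSubring_zero (hx : IsTowerSequence K (N + 1) x) (hN0 : N ≠ 0) :
    ∃ V : ValuationSubring Ω, (∀ a : K, V.valuation (algebraMap K Ω a) ≤ 1) ∧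
      ∀ i, V.valuation (x i) < 1 := by
  obtain ⟨V, hV, h0⟩ := exists_valuationSubring_of_transcendental hx.transcendental
  refine ⟨V, hV, fun i => ?_⟩
  induction i with
  | zero => exact h0
  | succ i ih =>
    refine valuation_lt_one_of_pow hN0 ?_
    have h1 := valuation_pow_sub_pow_lt (V := V) (a := 1) (b := x i + 1) (by simp)
      (V.valuation.map_add_le ih.le (by simp)) (by simpa using ih) N
    have h2 := hx.equation i
    rw [Nat.add_sub_cancel] at h2
    rwa [one_pow, ← eq_sub_of_add_eq h2] at h1

/-- The generator `x_{r+1}` has degree `N` over `F_r`. -/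
theorem eq_zero_of_eval_eq_zero (hx : IsTowerSequence K (N + 1) x) (hN0 : N ≠ 0)
    (hfrob : ∀ a : Ω, (a + 1) ^ (N + 1) = a ^ (N + 1) + 1) (r : ℕ) (P : (level K x r)[X])
    (hdeg : P.degree < N) (hP : aeval (x (r + 1)) P = 0) : P = 0 := by
  obtain ⟨V, hV, h0⟩ := exists_valuationSubring_zero hx hN0
  have H := hx.isTowerUpTo_levelSeq hN0 hfrob r
  let W := V.comap (level K x r).val.toRingHom
  let y := levelSeq K x r
  have hWlt : ∀ f : level K x r, W.valuation f < 1 ↔ V.valuation (f : Ω) < 1 :=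
    valuation_comap_lt_one V _
  have hWy : ∀ i ≤ r, W.valuation (y i) < 1 := fun i hi => by
    rw [hWlt, coe_levelSeq hi]
    exact h0 i
  have hmax := exists_uniformizer_of_zero (V := W) H (exists_div_of_level r) hN0
    (fun a => (valuation_comap_le_one V _ _).mpr (hV a)) hWy
  have hy := hWy r le_rfl
  have hy1 : W.valuation (1 + y r) = 1 := W.valuation.map_one_add_of_lt hy
  have hyN : W.valuation (1 - y r ^ N) = 1 :=
    W.valuation.map_one_sub_of_lt (by rw [map_pow]; exact pow_lt_one₀ zero_le hy hN0)
  have hirr := irreducible_X_pow_sub_C_of_uniformizer W (u := (1 - y r ^ N) / (1 + y r)) hy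
    (H.ne_zero le_rfl) hmax (by rw [map_div₀, hy1, hyN, div_one]) rfl hN0
  set a := y r * ((1 - y r ^ N) / (1 + y r)) with ha
  have hroot : aeval (x (r + 1)) (X ^ N - C a) = 0 := by
    have h1 := (hx.isTowerUpTo hN0 hfrob (r + 1)).eqn' (i := r) (by omega)
    have h2 := (hx.isTowerUpTo hN0 hfrob (r + 1)).add_one_ne_zero (i := r) (by omega)
    have h3 : (a : Ω) = x r * ((1 - x r ^ N) / (1 + x r)) := by
      rw [ha, ← coe_levelSeq (K := K) (x := x) (le_refl r)]
      simp [y]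
    rw [aeval_sub, map_pow, aeval_X, aeval_C]
    change _ - (a : Ω) = 0
    rw [add_comm] at h2
    rw [h3, sub_eq_zero, ← mul_div_assoc, eq_div_iff h2, h1]
  have hmin := minpoly.eq_of_irreducible_of_monic hirr hroot (monic_X_pow_sub_C a hN0)
  refine eq_zero_of_dvd_of_degree_lt (hmin ▸ minpoly.dvd _ _ hP) ?_
  rwa [degree_X_pow_sub_C (Nat.pos_of_ne_zero hN0)]

/-- A valuation ring can be changed, without affecting `F_r`, so that `x_{r+1} / b` reduces to any
given `N`-th root of the residue of its `N`-th power. -/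
theorem exists_valuationSubring_succ (hx : IsTowerSequence K (N + 1) x) (hN0 : N ≠ 0)
    (hfrob : ∀ a : Ω, (a + 1) ^ (N + 1) = a ^ (N + 1) + 1) (r : ℕ) (V : ValuationSubring Ω)
    (hV : ∀ a : K, V.valuation (algebraMap K Ω a) ≤ 1) {b : Ω} (hb : b ∈ level K x r)
    (hb0 : b ≠ 0) (c : K)
    (hc : V.valuation ((x (r + 1) / b) ^ N - algebraMap K Ω (c ^ N)) < 1) :
    ∃ V' : ValuationSubring Ω, (∀ f ∈ level K x r, V'.valuation f ≤ 1 ↔ V.valuation f ≤ 1) ∧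
      (∀ f ∈ level K x r, V'.valuation f < 1 ↔ V.valuation f < 1) ∧
      V'.valuation (x (r + 1) / b - algebraMap K Ω c) < 1 := by
  have hxr : x r ∈ level K x r := (gen K x (le_refl r)).2
  have hpow : x (r + 1) ^ N = 1 - (x r + 1) ^ N := eq_sub_of_add_eq (hx.equation r)
  refine exists_valuationSubring_root (level K x r).toSubfield V (z := x (r + 1) / b)
    (a := (x (r + 1) / b) ^ N) (c := algebraMap K Ω c) ?_ ((level K x r).algebraMap_mem c) rfl hN0
    ?_ (hV c) (by rwa [← map_pow])
  · rw [div_pow, hpow]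
    exact div_mem (sub_mem (one_mem _) (pow_mem (add_mem hxr (one_mem _)) N)) (pow_mem hb N)
  · intro P hdeg hP
    have h1 := scaleRoots_eval₂_mul (p := P) (level K x r).toSubfield.subtype (x (r + 1) / b)
      ⟨b, hb⟩
    rw [hP, mul_zero] at h1
    have h2 : P.scaleRoots ⟨b, hb⟩ = 0 := by
      refine eq_zero_of_eval_eq_zero hx hN0 hfrob r _ ?_ ?_
      · rwa [degree_scaleRoots]
      · change eval₂ _ (b * (x (r + 1) / b)) _ = 0 at h1
        rw [mul_div_cancel₀ _ hb0] at h1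
        exact h1
    by_contra h0
    exact scaleRoots_ne_zero h0 _ h2

/-- The places are constructed as valuation rings of the ambient field `Ω`, so that there is no need
to extend them from one level to the next. -/
theorem exists_valuationSubring_neg_one (hx : IsTowerSequence K (N + 1) x) (hN0 : N ≠ 0)
    (hev : Even N) (hfrob : ∀ a : Ω, (a + 1) ^ (N + 1) = a ^ (N + 1) + 1) (r : ℕ) :
    ∃ V : ValuationSubring Ω, (∀ a : K, V.valuation (algebraMap K Ω a) ≤ 1) ∧
      V.valuation (x r + 1) < 1 := by
  induction r with
  | zero =>
    refine exists_valuationSubring_of_transcendental fun h => hx.transcendental ?_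
    simpa using h.sub isAlgebraic_one
  | succ r ih =>
    obtain ⟨V, hV, hr⟩ := ih
    obtain ⟨V', h1, -, h3⟩ := exists_valuationSubring_succ hx hN0 hfrob r V hV (b := 1)
      (one_mem _) one_ne_zero (-1) (by
        have h2 : x (r + 1) ^ N = 1 - (x r + 1) ^ N := eq_sub_of_add_eq (hx.equation r)
        rw [div_one, hev.neg_one_pow, map_one, h2, sub_sub_cancel_left, Valuation.map_neg, map_pow]
        exact pow_lt_one₀ zero_le hr hN0)
    exact ⟨V', fun a => (h1 _ ((level K x r).algebraMap_mem a)).mpr (hV a), by simpa using h3⟩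

theorem exists_valuationSubring_const (hx : IsTowerSequence K (N + 1) x) (hN0 : N ≠ 0)
    (hev : Even N) (hfrob : ∀ a : Ω, (a + 1) ^ (N + 1) = a ^ (N + 1) + 1) {m : ℕ} (hm : 1 ≤ m)
    {α : K} (hα : α ^ N = 1) :
    ∃ V : ValuationSubring Ω, (∀ a : K, V.valuation (algebraMap K Ω a) ≤ 1) ∧
      V.valuation (x m - algebraMap K Ω α) < 1 := by
  obtain ⟨r, rfl⟩ : ∃ r, m = r + 1 := ⟨m - 1, by omega⟩
  obtain ⟨V, hV, hr⟩ := exists_valuationSubring_neg_one hx hN0 hev hfrob r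
  obtain ⟨V', h1, -, h3⟩ := exists_valuationSubring_succ hx hN0 hfrob r V hV (b := 1)
    (one_mem _) one_ne_zero α (by
      have h2 : x (r + 1) ^ N = 1 - (x r + 1) ^ N := eq_sub_of_add_eq (hx.equation r)
      rw [div_one, hα, map_one, h2, sub_sub_cancel_left, Valuation.map_neg, map_pow]
      exact pow_lt_one₀ zero_le hr hN0)
  exact ⟨V', fun a => (h1 _ ((level K x r).algebraMap_mem a)).mpr (hV a), by simpa using h3⟩

theorem mem_level {n i : ℕ} (h : i ≤ n) : x i ∈ level K x n := (gen K x h).2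

theorem exists_valuationSubring_ratio (hx : IsTowerSequence K (N + 1) x) (hN0 : N ≠ 0)
    (hev : Even N) (hfrob : ∀ a : Ω, (a + 1) ^ (N + 1) = a ^ (N + 1) + 1) {m j : ℕ} (hm : 1 ≤ m)
    (hjm : j ≤ m) {α : K} (hα : α ^ N = 1) (hα' : 1 ≤ j → (1 + α) ^ N = 1) (c : K)
    (hc : 1 ≤ j → c ^ N ^ j = α / (1 + α)) :
    ∃ V : ValuationSubring Ω, (∀ a : K, V.valuation (algebraMap K Ω a) ≤ 1) ∧
      V.valuation (x m - algebraMap K Ω α) < 1 ∧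
      (1 ≤ j → V.valuation (ratio x m j - algebraMap K Ω c) < 1) := by
  have step : ∀ i ≤ j, ∃ V : ValuationSubring Ω, (∀ a : K, V.valuation (algebraMap K Ω a) ≤ 1) ∧
      V.valuation (x m - algebraMap K Ω α) < 1 ∧
      (1 ≤ i → V.valuation (ratio x m i - algebraMap K Ω (chain N j c i)) < 1) := by
    intro i
    induction i with
    | zero =>
      intro _
      obtain ⟨V, hV, h⟩ := exists_valuationSubring_const hx hN0 hev hfrob hm hα
      exact ⟨V, hV, h, fun h0 => absurd h0 (by omega)⟩
    | succ i ih =>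
      intro hij
      obtain ⟨V, hV, hVm, hVi⟩ := ih (by omega)
      have H := hx.isTowerUpTo hN0 hfrob (m + j)
      obtain ⟨-, hone, hsucc⟩ := valuation_ratio H hN0 hev hV hm hjm le_rfl hα (hα' (by omega)) hVm
      have hb : x (m - (i + 1)) + 1 ∈ level K x (m + i) :=
        add_mem (mem_level (by omega)) (one_mem _)
      obtain ⟨V', h1, h2, h3⟩ := exists_valuationSubring_succ hx hN0 hfrob (m + i) V hV hb
        (H.add_one_ne_zero (by omega)) (chain N j c (i + 1)) (by
          change V.valuation (ratio x m (i + 1) ^ N - _) < 1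
          rcases Nat.eq_zero_or_pos i with rfl | hi
          · rw [zero_add, chain_one_pow hev (by omega), hc (by omega)]
            exact hone (by omega)
          · rw [chain_succ_pow hev (by omega)]
            have h4 := V.valuation.map_sub_lt (hsucc i hi (by omega)) (hVi hi)
            convert h4 using 2
            rw [map_neg]
            ring)
      refine ⟨V', fun a => (h1 _ ((level K x _).algebraMap_mem a)).mpr (hV a),
        (h2 _ (sub_mem (mem_level (by omega)) ((level K x _).algebraMap_mem α))).mpr hVm,
        fun _ => h3⟩
  obtain ⟨V, hV, hVm, hVj⟩ := step j le_rfl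
  exact ⟨V, hV, hVm, fun h => by simpa [chain_self] using hVj h⟩

end Existence

end

/-! ### Counting the parameters -/

theorem add_one_pow_card {k F : Type*} [Field k] [Finite k] [Field F] (f : k →+* F) (a : F) :
    (a + 1) ^ Nat.card k = a ^ Nat.card k + 1 := by
  have := Fintype.ofFinite k
  obtain ⟨p, hp, e, hprime, hcard⟩ := FiniteField.card' k
  have : CharP F p := (f.charP_iff f.injective p).mp hp
  have : Fact p.Prime := ⟨hprime⟩
  rw [Nat.card_eq_fintype_card, hcard, add_pow_char_pow, one_pow]

theorem odd_card {k : Type*} [Field k] [Finite k] (hodd : Odd (ringChar k)) : Odd (Nat.card k) := by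
  have := Fintype.ofFinite k
  obtain ⟨e, -, hcard⟩ := FiniteField.card k (ringChar k)
  rw [Nat.card_eq_fintype_card, hcard]
  exact hodd.pow

/-- The `N`-th roots of unity in an extension of `𝔽_q` lie in `𝔽_q`, for `q = N + 1`. -/
theorem mem_range_of_pow_eq_one {k K : Type*} [Field k] [Finite k] [Field K] (f : k →+* K) {N : ℕ}
    (hk : Nat.card k = N + 1) (hN0 : N ≠ 0) {β : K} (hβ : β ^ N = 1) :
    ∃ a : k, a ≠ 0 ∧ f a = β := by
  classical
  have := Fintype.ofFinite k
  have hN : N = Fintype.card k - 1 := by rw [← Nat.card_eq_fintype_card, hk]; rfl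
  have hsub : (Finset.univ.erase (0 : k)).map ⟨f, f.injective⟩ ⊆ Polynomial.nthRootsFinset N 1 := by
    intro b hb
    obtain ⟨a, ha, rfl⟩ := Finset.mem_map.mp hb
    rw [Polynomial.mem_nthRootsFinset (Nat.pos_of_ne_zero hN0)]
    change f a ^ N = 1
    rw [← map_pow, hN, FiniteField.pow_card_sub_one_eq_one a (Finset.ne_of_mem_erase ha), map_one]
  have heq := Finset.eq_of_subset_of_card_le hsub (by
    rw [Finset.card_map, Finset.card_erase_of_mem (Finset.mem_univ _), Finset.card_univ, ← hN]
    refine (Multiset.toFinset_card_le _).trans (Polynomial.card_nthRoots N 1))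
  have hmem : β ∈ Polynomial.nthRootsFinset N (1 : K) :=
    (Polynomial.mem_nthRootsFinset (Nat.pos_of_ne_zero hN0) _).mpr hβ
  rw [← heq] at hmem
  obtain ⟨a, ha, rfl⟩ := Finset.mem_map.mp hmem
  exact ⟨a, Finset.ne_of_mem_erase ha, rfl⟩

theorem pow_eq_one_of_ne_zero {k K : Type*} [Field k] [Finite k] [Field K] (f : k →+* K) {N : ℕ}
    (hk : Nat.card k = N + 1) {a : k} (ha : a ≠ 0) : f a ^ N = 1 := by
  have := Fintype.ofFinite k
  have hN : N = Fintype.card k - 1 := by rw [← Nat.card_eq_fintype_card, hk]; rfl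
  rw [← map_pow, hN, FiniteField.pow_card_sub_one_eq_one a ha, map_one]

theorem natCast_ne_zero_of_card {k K : Type*} [Field k] [Finite k] [Field K] (f : k →+* K) {N : ℕ}
    (hk : Nat.card k = N + 1) : (N : K) ≠ 0 := by
  have := Fintype.ofFinite k
  have h0 : ((N + 1 : ℕ) : k) = 0 := by
    rw [← hk, Nat.card_eq_fintype_card]
    exact FiniteField.cast_card_eq_zero k
  have h1 : ((N + 1 : ℕ) : K) = 0 := by rw [← map_natCast f, h0, map_zero]
  rw [Nat.cast_add, Nat.cast_one] at h1
  rw [eq_neg_of_add_eq_zero_left h1]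
  simp

theorem pow_card_units_eq_one {K : Type*} [Field K] [Finite K] {c : K} (hc : c ≠ 0) :
    c ^ Nat.card Kˣ = 1 := by
  have h := congrArg Units.val (pow_card_eq_one' (x := Units.mk0 c hc))
  rwa [Units.val_pow_eq_pow_val, Units.val_mk0, Units.val_one] at h

theorem gcd_mul_pow_eq {N l j : ℕ} (hev : Even N) (hl : 2 ^ l ∣ N + 2)
    (hj1 : 1 ≤ j) (hjl : j ≤ l) : (N * (N + 2)).gcd (N ^ j) = 2 ^ (j - 1) * N := by
  obtain ⟨j, rfl⟩ : ∃ i, j = i + 1 := ⟨j - 1, by omega⟩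
  obtain ⟨M, rfl⟩ := hev
  rw [pow_succ', Nat.gcd_mul_left, Nat.add_sub_cancel, mul_comm]
  congr 1
  rcases Nat.eq_zero_or_pos j with rfl | hj
  · simp
  have h4 : 4 ∣ M + M + 2 := (pow_dvd_pow 2 (by omega : 2 ≤ l)).trans hl
  have hM : Nat.Coprime (M + M + 2) (M ^ j) := by
    refine Nat.Coprime.pow_right j ?_
    have h2 : Nat.gcd (M + M + 2) M = Nat.gcd 2 M := by
      rw [show M + M + 2 = 2 + M * 2 by ring, Nat.gcd_add_mul_left_left]
    rw [Nat.Coprime, h2]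
    exact (Nat.coprime_two_left).mpr (Nat.odd_iff.mpr (by omega))
  rw [← two_mul M, mul_pow, two_mul M, Nat.Coprime.gcd_mul_right_cancel_right _ hM.symm]
  exact Nat.gcd_eq_right ((pow_dvd_pow 2 (by omega)).trans hl)

theorem encard_pow_eq_neg_one {K : Type*} [Field K] [Finite K] {N l j : ℕ} (hN0 : N ≠ 0)
    (hK : Nat.card K = (N + 1) ^ 2) (hev : Even N) (h2 : (2 : K) ≠ 0)
    (hl : 2 ^ l ∣ N + 2) (hl' : ¬ 2 ^ (l + 1) ∣ N + 2) (hj1 : 1 ≤ j) :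
    (j ≤ l → {c : K | c ^ N ^ j = -1}.encard = ((2 ^ (j - 1) * N : ℕ) : ℕ∞)) ∧
    (l < j → {c : K | c ^ N ^ j = -1}.encard = 0) := by
  have hcard : Nat.card Kˣ = N * (N + 2) := by
    rw [Nat.card_units, hK]
    have : (N + 1) ^ 2 = N * (N + 2) + 1 := by ring
    omega
  have hne : (1 : K) ≠ -1 := fun h => h2 (by
    rw [← one_add_one_eq_two]; exact eq_neg_iff_add_eq_zero.mp h)
  constructor
  · intro hjl
    obtain ⟨g, hg⟩ := IsCyclic.exists_generator (α := Kˣ)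
    have hord : orderOf g = N * (N + 2) := by rw [orderOf_eq_card_of_forall_mem_zpowers hg, hcard]
    obtain ⟨M, hM⟩ : ∃ M, N = M + M := hev
    -- For `j ≥ 2` we have `l ≥ 2`, so `4 ∣ N + 2` and `M = N / 2` is odd.
    have hM1 : Odd (M ^ (j - 1)) := by
      rcases hj1.eq_or_lt with rfl | hj
      · simp
      · have h4 : 4 ∣ N + 2 := (pow_dvd_pow 2 (by omega : 2 ≤ l)).trans hl
        exact (Nat.odd_iff.mpr (by omega)).pow
    have hhalf : g ^ (N * (M + 1)) = -1 := by
      have hsq : ((g ^ (N * (M + 1)) : Kˣ) : K) ^ 2 = 1 := by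
        rw [← Units.val_pow_eq_pow_val, ← pow_mul,
          show N * (M + 1) * 2 = N * (N + 2) by rw [hM]; ring, ← hord, pow_orderOf_eq_one, Units.val_one]
      rcases sq_eq_one_iff.mp hsq with h | h
      · exfalso
        have h1 : g ^ (N * (M + 1)) = 1 := Units.ext h
        have h3 := Nat.le_of_dvd (by positivity) (orderOf_dvd_of_pow_eq_one h1)
        rw [hord] at h3
        have := Nat.le_of_mul_le_mul_left h3 (Nat.pos_of_ne_zero hN0)
        omega
      · exact Units.ext h
    obtain ⟨e, he⟩ := (pow_dvd_pow 2 hjl).trans hl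
    -- With `e = (N + 2) / 2 ^ j`, `e * N ^ j` is an odd multiple of half the group order.
    have hroot : (g ^ e) ^ N ^ j = -1 := by
      have h3 : e * N ^ j = N * (M + 1) * M ^ (j - 1) := by
        obtain ⟨i, rfl⟩ : ∃ i, j = i + 1 := ⟨j - 1, by omega⟩
        have h5 : M + 1 = 2 ^ i * e := by
          rw [pow_succ] at he
          have : 2 * (M + 1) = 2 * (2 ^ i * e) := by linarith
          omega
        have h6 : N ^ i = 2 ^ i * M ^ i := by rw [hM, ← two_mul, mul_pow]
        rw [h5, pow_succ, h6, Nat.add_sub_cancel]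
        ring
      rw [← pow_mul, h3, pow_mul, hhalf, hM1.neg_one_pow]
    have himg : {c : K | c ^ N ^ j = -1} = (fun u : Kˣ => ((g ^ e * u : Kˣ) : K)) ''
        ((powMonoidHom (N ^ j) : Kˣ →* Kˣ).ker : Set Kˣ) := by
      ext c
      constructor
      · intro hc
        have hc' : c ^ N ^ j = -1 := hc
        have hc0 : c ≠ 0 := by
          rintro rfl
          rw [zero_pow (pow_ne_zero _ hN0)] at hc'
          simp at hc'
        refine ⟨(g ^ e)⁻¹ * Units.mk0 c hc0, ?_, by simp⟩
        have h3 : Units.mk0 c hc0 ^ N ^ j = -1 := Units.ext (by simpa using hc')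
        change ((g ^ e)⁻¹ * Units.mk0 c hc0) ^ N ^ j = 1
        rw [mul_pow, inv_pow, hroot, h3, inv_mul_cancel]
      · rintro ⟨u, hu, rfl⟩
        have hu' : u ^ N ^ j = 1 := hu
        change (((g ^ e * u : Kˣ) : K)) ^ N ^ j = -1
        rw [← Units.val_pow_eq_pow_val, mul_pow, hroot, hu', mul_one]
        simp
    rw [himg, Function.Injective.encard_image]
    · rw [← gcd_mul_pow_eq ⟨M, hM⟩ hl hj1 hjl, ← hcard, ← IsCyclic.card_powMonoidHom_ker,
        ← Set.Finite.cast_ncard_eq (Set.toFinite _)]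
      rfl
    · intro u v huv
      exact mul_left_cancel (Units.ext huv)
  · intro hlj
    rw [Set.encard_eq_zero, Set.eq_empty_iff_forall_notMem]
    intro c hc
    have hc' : c ^ N ^ j = -1 := hc
    have hc0 : c ≠ 0 := by
      rintro rfl
      rw [zero_pow (pow_ne_zero _ hN0)] at hc'
      simp at hc'
    obtain ⟨e, he⟩ := hl
    have hodd : Odd e := by
      rw [← Nat.not_even_iff_odd]
      rintro ⟨d, rfl⟩
      exact hl' ⟨d, by rw [he, pow_succ]; ring⟩
    obtain ⟨s, hs⟩ : N * 2 ^ l ∣ N ^ j := by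
      obtain ⟨i, rfl⟩ : ∃ i, j = i + 1 := ⟨j - 1, by omega⟩
      rw [pow_succ']
      exact Nat.mul_dvd_mul_left N ((pow_dvd_pow 2 (by omega)).trans
        (pow_dvd_pow_of_dvd hev.two_dvd i))
    -- `N * 2 ^ l * e` is the group order and divides `N ^ j * e`, but `(-1) ^ e = -1`.
    have h1 : (c ^ N ^ j) ^ e = 1 := by
      have h3 : N * 2 ^ l * s * e = Nat.card Kˣ * s := by rw [hcard, he]; ring
      rw [hs, ← pow_mul, h3, pow_mul]
      rw [pow_card_units_eq_one hc0, one_pow]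
    rw [hc', hodd.neg_one_pow] at h1
    exact hne h1.symm

/-- The elements of `K` that parametrize the rational places where `x_m` has a residue in `k \ {0,
-1}`, as the residues of `z_j` for `j = min m (n - m)`. -/
def paramSet (k K : Type*) [Field k] [Field K] [Algebra k K] (N j : ℕ) : Set K :=
  {c | ∃ γ : k, γ ≠ 0 ∧ γ ≠ 1 ∧ c ^ N ^ j = algebraMap k K γ}

theorem encard_paramSet {k K : Type*} [Field k] [Finite k] [Field K] [Finite K] [Algebra k K]
    {N l j : ℕ} (hN0 : N ≠ 0)
    (hk : Nat.card k = N + 1) (hK : Nat.card K = (N + 1) ^ 2) (hev : Even N)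
    (hl : 2 ^ l ∣ N + 2) (hl' : ¬ 2 ^ (l + 1) ∣ N + 2) :
    (j = 0 → (paramSet k K N j).encard = ((N - 1 : ℕ) : ℕ∞)) ∧
    (1 ≤ j → j ≤ l → (paramSet k K N j).encard = ((2 ^ (j - 1) * N : ℕ) : ℕ∞)) ∧
    (1 ≤ j → l < j → (paramSet k K N j).encard = 0) := by
  have h2 : (2 : K) ≠ 0 := by
    obtain ⟨M, hM⟩ := hev
    intro h
    apply natCast_ne_zero_of_card (algebraMap k K) hk
    rw [hM, ← two_mul, Nat.cast_mul, Nat.cast_ofNat, h, zero_mul]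
  have hset : 1 ≤ j → paramSet k K N j = {c : K | c ^ N ^ j = -1} := by
    intro hj
    obtain ⟨i, rfl⟩ : ∃ i, j = i + 1 := ⟨j - 1, by omega⟩
    ext c
    constructor
    · rintro ⟨γ, h0, h1, hc⟩
      have hc0 : c ≠ 0 := by
        rintro rfl
        rw [zero_pow (pow_ne_zero _ hN0), eq_comm, map_eq_zero] at hc
        exact h0 hc
      have hγ : algebraMap k K γ ^ (N + 2) = 1 := by
        have h3 : N ^ (i + 1) * (N + 2) = Nat.card Kˣ * N ^ i := by
          rw [Nat.card_units, hK, show (N + 1) ^ 2 - 1 = N * (N + 2) by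
            have : (N + 1) ^ 2 = N * (N + 2) + 1 := by ring
            omega]
          ring
        rw [← hc, ← pow_mul, h3, pow_mul]
        rw [pow_card_units_eq_one hc0, one_pow]
      rw [pow_add, pow_eq_one_of_ne_zero (algebraMap k K) hk h0, one_mul] at hγ
      -- Now `γ ^ 2 = 1`, because `γ ^ N = 1` and `γ ^ (N + 2) = 1`.
      rcases sq_eq_one_iff.mp hγ with h | h
      · exact absurd ((algebraMap k K).injective (h.trans (map_one _).symm)) h1
      · exact hc.trans h
    · intro hc
      have hc' : c ^ N ^ (i + 1) = -1 := hc
      refine ⟨-1, by simp, fun h => h2 ?_, by simpa using hc'⟩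
      have := congrArg (algebraMap k K) h
      rw [map_neg, map_one] at this
      linear_combination -this
  refine ⟨?_, fun hj => ?_, fun hj => ?_⟩
  · rintro rfl
    have : paramSet k K N 0 = algebraMap k K '' ({0, 1}ᶜ : Set k) := by
      ext c
      constructor
      · rintro ⟨γ, h0, h1, hc⟩
        exact ⟨γ, by simp [h0, h1], by simpa using hc.symm⟩
      · rintro ⟨γ, hγ, rfl⟩
        simp only [Set.mem_compl_iff, Set.mem_insert_iff, Set.mem_singleton_iff, not_or] at hγ
        exact ⟨γ, hγ.1, hγ.2, by simp⟩
    rw [this, (algebraMap k K).injective.encard_image,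
      ← Set.Finite.cast_ncard_eq (Set.toFinite _), Set.ncard_compl, hk,
      Set.ncard_pair zero_ne_one]
    rfl
  · rw [hset hj]
    exact (encard_pow_eq_neg_one hN0 hK hev h2 hl hl' hj).1
  · rw [hset hj]
    exact (encard_pow_eq_neg_one hN0 hK hev h2 hl hl' hj).2

/-! ### Counting the rational places -/

/-- Two sets have the same cardinality if a relation restricts to a bijection between them. -/
theorem encard_eq_of_rel {α β : Type*} {S : Set α} {D : Set β} (R : α → β → Prop)
    (h1 : ∀ a ∈ S, ∃ b ∈ D, R a b) (h2 : ∀ b ∈ D, ∃ a ∈ S, R a b)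
    (h3 : ∀ a ∈ S, ∀ b b', R a b → R a b' → b = b')
    (h4 : ∀ a ∈ S, ∀ a' ∈ S, ∀ b, R a b → R a' b → a = a') : S.encard = D.encard := by
  rcases S.eq_empty_or_nonempty with rfl | ⟨s, hs⟩
  · have : D = ∅ := Set.eq_empty_iff_forall_notMem.mpr fun b hb => by
      obtain ⟨a, ha, -⟩ := h2 b hb
      exact ha
    simp [this]
  have : Nonempty β := (h1 s hs).nonempty
  choose! f hfD hf using h1
  have hinj : Set.InjOn f S := fun a ha a' ha' h => h4 a ha a' ha' (f a) (hf a ha) (h ▸ hf a' ha')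
  rw [← hinj.encard_image]
  congr 1
  ext b
  constructor
  · rintro ⟨a, ha, rfl⟩
    exact hfD a ha
  · intro hb
    obtain ⟨a, ha, hab⟩ := h2 b hb
    exact ⟨a, ha, h3 a ha _ _ (hf a ha) hab⟩

/-- The restriction to `F` of a valuation ring of `Ω`, as a place. The element `f` witnesses that
the restriction is not trivial. -/
def Place.ofValuationSubring {K Ω F : Type*} [Field K] [Field Ω] [Algebra K Ω] [Field F]
    [Algebra K F] (φ : F →ₐ[K] Ω) (V : ValuationSubring Ω)
    (hV : ∀ a : K, V.valuation (algebraMap K Ω a) ≤ 1) (f : F) (hf0 : f ≠ 0)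
    (hf : V.valuation (φ f) < 1) : Place K F where
  ring := V.comap (φ : F →+* Ω)
  algebraMap_mem a := by
    rw [← ValuationSubring.valuation_le_one_iff, valuation_comap_le_one]
    simpa using hV a
  ne_top h := by
    have h1 : f⁻¹ ∈ V.comap (φ : F →+* Ω) := h ▸ ValuationSubring.mem_top _
    rw [← ValuationSubring.valuation_le_one_iff, valuation_comap_le_one, map_inv₀, map_inv₀] at h1
    have h2 : φ f ≠ 0 := (map_ne_zero φ).mpr hf0
    exact absurd h1 (not_le.mpr ((one_lt_inv₀ ((Valuation.pos_iff _).mpr h2)).mpr hf))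

theorem Place.valuation_algebraMap_le {K F : Type*} [Field K] [Field F] [Algebra K F]
    (P : Place K F) (a : K) : P.ring.valuation (algebraMap K F a) ≤ 1 :=
  (P.ring.valuation_le_one_iff _).mpr (P.algebraMap_mem a)

theorem Place.isZero_add_one_iff {K F : Type*} [Field K] [Field F] [Algebra K F]
    (P : Place K F) (f : F) :
    P.IsZero (f + 1) ↔ P.ring.valuation (f - algebraMap K F (-1)) < 1 := by
  rw [map_neg, map_one, sub_neg_eq_add]
  rfl

theorem one_add_algebraMap_ne_zero {k K : Type*} [Field k] [Field K] [Algebra k K] {a : k}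
    (ha : a ≠ -1) : 1 + algebraMap k K a ≠ 0 := by
  rw [← map_one (algebraMap k K), ← map_add]
  exact (map_ne_zero _).mpr fun h => ha (eq_neg_of_add_eq_zero_right h)

section Count

variable {k K Ω : Type*} [Field k] [Finite k] [Field K] [Algebra k K] [Field Ω] [Algebra K Ω]
  {N n m : ℕ} {x : ℕ → Ω}

variable (k K x) in
/-- The rational places of `F_n` that are zeros of `x_m - α` for some `α ∈ k` other than `0` and
`-1`. -/
def rationalZeros (n m : ℕ) : Set (Place K (level K x n)) :=
  {Q | Q.IsRational ∧ ∃ α : k, α ≠ 0 ∧ α ≠ -1 ∧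
    Q.IsZero (levelSeq K x n m - algebraMap K _ (algebraMap k K α))}

theorem one_add_pow_eq_one (hk : Nat.card k = N + 1) {a : k} (ha : a ≠ -1) :
    (1 + algebraMap k K a) ^ N = 1 := by
  rw [← map_one (algebraMap k K), ← map_add]
  refine (pow_eq_one_of_ne_zero (algebraMap k K) hk fun h => ha ?_).trans (map_one _).symm
  exact eq_neg_of_add_eq_zero_right h

/-- For `j = 0` the parameter of a place is the residue of `z_0 = x_m / (x_m + 1)`. -/
theorem ratio_zero_residue {F : Type*} [Field F] [Algebra K F] {V : ValuationSubring F}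
    (hV : ∀ a : K, V.valuation (algebraMap K F a) ≤ 1) {y : ℕ → F} {α : K} (hα : 1 + α ≠ 0)
    (hy : V.valuation (y m - algebraMap K F α) < 1) :
    V.valuation (ratio y m 0 - algebraMap K F (α / (1 + α))) < 1 := by
  have hm1 : V.valuation (y m + 1 - algebraMap K F (1 + α)) < 1 := by
    rw [map_add, map_one]
    convert hy using 2
    ring
  have h1 := valuation_eq_one_of_sub_lt hV hα hm1
  have h2 := valuation_algebraMap_eq_one hV hα
  have h10 : y m + 1 ≠ 0 := by intro h; simp [h] at h1
  have h20 : algebraMap K F (1 + α) ≠ 0 := (map_ne_zero _).mpr hα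
  have h3 : ratio y m 0 - algebraMap K F (α / (1 + α)) =
      (y m - algebraMap K F α) / ((y m + 1) * algebraMap K F (1 + α)) := by
    rw [ratio, Nat.add_zero, Nat.sub_zero, map_div₀]
    rw [eq_div_iff (mul_ne_zero h10 h20)]
    field_simp
    rw [map_add, map_one]
    ring
  rw [h3, map_div₀, map_mul, h1, h2, mul_one, div_one]
  exact hy

/-- The residue of `z_j`, `j = min m (n - m)`, parametrizes the rational zeros of `x_m - α`. -/
theorem encard_rationalZeros (hk : Nat.card k = N + 1) (hN0 : N ≠ 0) (hev : Even N)
    (hx : IsTowerSequence K (N + 1) x) (hm : 1 ≤ m) (hmn : m ≤ n) :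
    (rationalZeros k K x n m).encard = (paramSet k K N (min m (n - m))).encard := by
  have hfrob : ∀ a : Ω, (a + 1) ^ (N + 1) = a ^ (N + 1) + 1 :=
    hk ▸ add_one_pow_card ((algebraMap K Ω).comp (algebraMap k K))
  have hNK : (N : K) ≠ 0 := natCast_ne_zero_of_card (algebraMap k K) hk
  have H := hx.isTowerUpTo_levelSeq hN0 hfrob n
  obtain ⟨j, hj⟩ : ∃ j, j = min m (n - m) := ⟨_, rfl⟩
  rw [← hj]
  have hone : ∀ a : k, a ≠ 0 → algebraMap k K a ^ N = 1 := fun a ha =>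
    pow_eq_one_of_ne_zero (algebraMap k K) hk ha
  have hres : ∀ (V : ValuationSubring (level K x n))
      (_ : ∀ a : K, V.valuation (algebraMap K (level K x n) a) ≤ 1) (a : k) (_ : a ≠ 0)
      (_ : a ≠ -1) (_ : V.valuation (levelSeq K x n m - algebraMap K _ (algebraMap k K a)) < 1)
      (c : K) (_ : V.valuation (ratio (levelSeq K x n) m j - algebraMap K _ c) < 1),
      HasResidues V (levelSeq K x n) m j n (algebraMap k K a) (chain N j c) ∧
        c ^ N ^ j = algebraMap k K a / (1 + algebraMap k K a) := by
    intro V hV a h0 h1 ha c hc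
    obtain ⟨h2, h3⟩ := hasResidues_of_valuation_sub_lt H hN0 hev hV hm hmn hj (hone a h0)
      (fun _ => one_add_pow_eq_one hk h1) ha c (fun _ => hc)
    refine ⟨h2, ?_⟩
    rcases Nat.eq_zero_or_pos j with h | h
    · rw [h, pow_zero, pow_one]
      rw [h] at hc
      exact eq_of_valuation_sub_lt hV hc
        (ratio_zero_residue hV (one_add_algebraMap_ne_zero h1) ha)
    · exact h3 h
  have hrel : ∀ (a : k) (c : K), a ≠ -1 →
      c ^ N ^ j = algebraMap k K a / (1 + algebraMap k K a) → 1 ≤ j →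
      chain N j c 1 ^ N * (1 + algebraMap k K a) = algebraMap k K a := by
    intro a c h1 h hj1
    rw [chain_one_pow hev hj1, h, div_mul_cancel₀ _ (one_add_algebraMap_ne_zero h1)]
  refine encard_eq_of_rel
    (fun Q c => Q.ring.valuation (ratio (levelSeq K x n) m j - algebraMap K _ c) < 1) ?_ ?_ ?_ ?_
  · rintro Q ⟨hQ, a, h0, h1, ha⟩
    have hle : Q.ring.valuation (ratio (levelSeq K x n) m j) ≤ 1 := by
      rcases Nat.eq_zero_or_pos j with h | h
      · rw [h]
        exact valuation_le_one_of_sub_lt Q.valuation_algebraMap_le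
          (ratio_zero_residue Q.valuation_algebraMap_le (one_add_algebraMap_ne_zero h1) ha)
      · exact ((valuation_ratio H hN0 hev Q.valuation_algebraMap_le hm (by omega : j ≤ m)
          (by omega) (hone a h0) (one_add_pow_eq_one hk h1) ha).1 j h le_rfl).le
    obtain ⟨c, hc⟩ := Q.isRational_iff.mp hQ _ hle
    refine ⟨c, ⟨a / (1 + a), ?_, ?_, ?_⟩, hc⟩
    · exact div_ne_zero h0 fun h => h1 (eq_neg_of_add_eq_zero_right h)
    · intro h
      rw [div_eq_one_iff_eq fun h => h1 (eq_neg_of_add_eq_zero_right h)] at h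
      simp at h
    · rw [map_div₀, map_add, map_one]
      exact (hres Q.ring Q.valuation_algebraMap_le a h0 h1 ha c hc).2
  · rintro c ⟨γ, h0, h1, hc⟩
    have h1' : 1 - γ ≠ 0 := sub_ne_zero.mpr (Ne.symm h1)
    -- The solution of `α / (1 + α) = γ`.
    obtain ⟨a, ha⟩ : ∃ a, a = γ / (1 - γ) := ⟨_, rfl⟩
    have ha0 : a ≠ 0 := ha ▸ div_ne_zero h0 h1'
    have ha1 : 1 + a = (1 - γ)⁻¹ := by rw [ha]; field_simp; ring
    have ha1' : a ≠ -1 := fun h => inv_ne_zero h1' (by rw [← ha1, h]; ring)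
    have hγ : algebraMap k K γ = algebraMap k K a / (1 + algebraMap k K a) := by
      rw [← map_one (algebraMap k K), ← map_add, ← map_div₀]
      congr 1
      rw [ha1, ha]
      field_simp
    rw [hγ] at hc
    obtain ⟨V, hV, hVm, hVj⟩ := exists_valuationSubring_ratio hx hN0 hev hfrob hm
      (by omega : j ≤ m) (hone a ha0) (fun _ => one_add_pow_eq_one hk ha1') c (fun _ => hc)
    have hVm' : V.valuation ((level K x n).val
        (levelSeq K x n m - algebraMap K _ (algebraMap k K a))) < 1 := by
      rw [map_sub, AlgHom.commutes]
      change V.valuation ((levelSeq K x n m : Ω) - _) < 1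
      rwa [coe_levelSeq hmn]
    let Q := Place.ofValuationSubring (level K x n).val V hV
      (levelSeq K x n m - algebraMap K _ (algebraMap k K a))
      (sub_ne_zero.mpr (H.ne_const m hmn _)) hVm'
    have hQm : Q.IsZero (levelSeq K x n m - algebraMap K _ (algebraMap k K a)) :=
      (valuation_comap_lt_one V _ _).mpr hVm'
    have hQj : Q.ring.valuation (ratio (levelSeq K x n) m j - algebraMap K _ c) < 1 := by
      rcases Nat.eq_zero_or_pos j with h | h
      · have h2 := ratio_zero_residue Q.valuation_algebraMap_le
          (one_add_algebraMap_ne_zero ha1') hQm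
        rw [← hc, h, pow_zero, pow_one] at h2
        rwa [h]
      · refine (valuation_comap_lt_one V _ _).mpr ?_
        change V.valuation (((ratio (levelSeq K x n) m j : level K x n) : Ω) - _) < 1
        rw [coe_ratio_levelSeq (by omega)]
        exact hVj h
    refine ⟨Q, ⟨?_, a, ha0, ha1', hQm⟩, hQj⟩
    obtain ⟨hR, -⟩ := hres Q.ring Q.valuation_algebraMap_le a ha0 ha1' hQm c hQj
    exact Q.isRational_iff.mpr (hR.valuationSubring_of_adjoin H (exists_div_of_level n) hNK hev hm
      hmn hj (hone a ha0) (fun _ => one_add_algebraMap_ne_zero ha1') (hrel a c ha1' hc)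
      (fun i _ hi => chain_succ_pow hev hi c)).2
  · intro Q _ c c' hc hc'
    exact eq_of_valuation_sub_lt Q.valuation_algebraMap_le hc hc'
  · rintro Q ⟨-, a, h0, h1, ha⟩ Q' ⟨-, a', h0', h1', ha'⟩ c hc hc'
    obtain ⟨hR, hca⟩ := hres Q.ring Q.valuation_algebraMap_le a h0 h1 ha c hc
    obtain ⟨hR', hca'⟩ := hres Q'.ring Q'.valuation_algebraMap_le a' h0' h1' ha' c hc'
    have haa : algebraMap k K a = algebraMap k K a' := by
      have h := hca.symm.trans hca'
      rw [div_eq_div_iff (one_add_algebraMap_ne_zero h1) (one_add_algebraMap_ne_zero h1')] at h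
      linear_combination h
    rw [← haa] at hR'
    exact Place.ext (hR.unique hR' H (exists_div_of_level n) hNK hev hm hmn hj (hone a h0)
      (fun _ => one_add_algebraMap_ne_zero h1) (hrel a c h1 hca)
      (fun i _ hi => chain_succ_pow hev hi c))

/-- There is exactly one rational place where all `x_i` have the residue `-1`. -/
theorem encard_neg_one (hk : Nat.card k = N + 1) (hN0 : N ≠ 0) (hev : Even N)
    (hx : IsTowerSequence K (N + 1) x) (hn : 1 ≤ n) :
    {Q : Place K (level K x n) | Q.IsRational ∧ Q.IsZero (levelSeq K x n n + 1)}.encard = 1 := by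
  have hfrob : ∀ a : Ω, (a + 1) ^ (N + 1) = a ^ (N + 1) + 1 :=
    hk ▸ add_one_pow_card ((algebraMap K Ω).comp (algebraMap k K))
  have hNK : (N : K) ≠ 0 := natCast_ne_zero_of_card (algebraMap k K) hk
  have H := hx.isTowerUpTo_levelSeq hN0 hfrob n
  have hα : (-1 : K) ^ N = 1 := hev.neg_one_pow
  have hres : ∀ Q : Place K (level K x n), Q.IsZero (levelSeq K x n n + 1) →
      HasResidues Q.ring (levelSeq K x n) n 0 n (-1 : K) (chain N 0 0) := fun Q hQ =>
    (hasResidues_of_valuation_sub_lt (α := (-1 : K)) (j := 0) H hN0 hev Q.valuation_algebraMap_le hn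
      le_rfl (by omega) hα
      (fun h => absurd h (lt_irrefl n)) ((Q.isZero_add_one_iff _).mp hQ) 0
      (fun h => absurd h (by omega))).1
  rw [Set.encard_eq_one]
  obtain ⟨V, hV, hVn⟩ := exists_valuationSubring_neg_one hx hN0 hev hfrob n
  have hVn' : V.valuation ((level K x n).val (levelSeq K x n n + 1)) < 1 := by
    rw [map_add, map_one]
    change V.valuation ((levelSeq K x n n : Ω) + 1) < 1
    rwa [coe_levelSeq le_rfl]
  let Q := Place.ofValuationSubring (level K x n).val V hV _ (H.add_one_ne_zero le_rfl) hVn'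
  have hQ : Q.IsZero (levelSeq K x n n + 1) := (valuation_comap_lt_one V _ _).mpr hVn'
  refine ⟨Q, Set.eq_singleton_iff_unique_mem.mpr ⟨⟨?_, hQ⟩, ?_⟩⟩
  · exact Q.isRational_iff.mpr ((hres Q hQ).valuationSubring_of_adjoin H (exists_div_of_level n)
      hNK hev hn le_rfl (by omega) hα (fun h => absurd h (by omega))
      (fun h => absurd h (by omega)) (fun i _ hi => absurd hi (by omega))).2
  · rintro Q' ⟨-, hQ'⟩
    exact Place.ext ((hres Q' hQ').unique (hres Q hQ) H (exists_div_of_level n) hNK hev hn le_rfl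
      (by omega) hα (fun h => absurd h (by omega)) (fun h => absurd h (by omega))
      (fun i _ hi => absurd hi (by omega)))

/-- At a rational zero of `x_0 + 1`, either all `x_i` have the residue `-1`, or there is a first `m`
for which `x_m` does not, and its residue is then another element of `𝔽_q^*`. -/
theorem rationalPlaces_above_eq (hk : Nat.card k = N + 1) (hN0 : N ≠ 0) (hev : Even N)
    (hx : IsTowerSequence K (N + 1) x) (hn : 1 ≤ n) :
    {Q : Place K (level K x n) | Q.IsRational ∧ Q.IsZero (levelSeq K x n 0 + 1)} =
      {Q | Q.IsRational ∧ Q.IsZero (levelSeq K x n n + 1)} ∪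
        ⋃ m ∈ (Finset.Icc 1 n : Set ℕ), rationalZeros k K x n m := by
  have hfrob : ∀ a : Ω, (a + 1) ^ (N + 1) = a ^ (N + 1) + 1 :=
    hk ▸ add_one_pow_card ((algebraMap K Ω).comp (algebraMap k K))
  have H := hx.isTowerUpTo_levelSeq hN0 hfrob n
  ext Q
  simp only [Set.mem_union, Set.mem_iUnion, Set.mem_ofPred_eq, Finset.coe_Icc, Set.mem_Icc,
    exists_prop]
  have hV := Q.valuation_algebraMap_le
  constructor
  · rintro ⟨hQ, h0⟩
    by_cases hall : Q.IsZero (levelSeq K x n n + 1)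
    · exact Or.inl ⟨hQ, hall⟩
    · right
      classical
      have hex : ∃ i, ¬ Q.IsZero (levelSeq K x n i + 1) := ⟨n, hall⟩
      obtain ⟨m, hm⟩ : ∃ m, Nat.find hex = m + 1 :=
        Nat.exists_eq_succ_of_ne_zero fun h => (h ▸ Nat.find_spec hex) h0
      have hspec := Nat.find_spec hex
      rw [hm] at hspec
      have hmin : Q.IsZero (levelSeq K x n m + 1) := not_not.mp (Nat.find_min hex (by omega))
      have hmn : m + 1 ≤ n := hm ▸ Nat.find_min' hex hall
      have heq := H.eqn m (by omega)
      have hpow : Q.ring.valuation (levelSeq K x n (m + 1) ^ N - 1) < 1 := by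
        rw [show levelSeq K x n (m + 1) ^ N - 1 = -(levelSeq K x n m + 1) ^ N by
          linear_combination heq, Valuation.map_neg, map_pow]
        exact pow_lt_one₀ zero_le hmin hN0
      have hle : Q.ring.valuation (levelSeq K x n (m + 1)) ≤ 1 := by
        have h1 : Q.ring.valuation (levelSeq K x n (m + 1) ^ N) ≤ 1 :=
          valuation_le_one_of_sub_lt hV (d := 1) (by rwa [map_one])
        rw [map_pow] at h1
        exact (pow_le_one_iff hN0).mp h1
      obtain ⟨β, hβ⟩ := Q.isRational_iff.mp hQ _ hle
      have hβN : β ^ N = 1 := by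
        have h1 := valuation_pow_sub_pow_lt hle (hV β) hβ N
        rw [← map_pow] at h1
        exact eq_of_valuation_sub_lt hV h1 (by rwa [map_one])
      obtain ⟨a, ha0, rfl⟩ := mem_range_of_pow_eq_one (algebraMap k K) hk hN0 hβN
      refine ⟨m + 1, ⟨by omega, hmn⟩, hQ, a, ha0, ?_, hβ⟩
      rintro rfl
      exact hspec ((Q.isZero_add_one_iff _).mpr (by simpa using hβ))
  · rintro (⟨hQ, h⟩ | ⟨m, ⟨hm1, hmn⟩, hQ, a, ha0, ha1, ha⟩)
    · exact ⟨hQ, valuation_add_one_lt_of_valuation_sub_lt H hN0 hev hV le_rfl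
        (α := -1) hev.neg_one_pow ((Q.isZero_add_one_iff _).mp h) 0 hn⟩
    · exact ⟨hQ, valuation_add_one_lt_of_valuation_sub_lt H hN0 hev hV hmn
        (pow_eq_one_of_ne_zero (algebraMap k K) hk ha0) ha 0 (by omega)⟩

theorem encard_rationalPlaces_above (hk : Nat.card k = N + 1) (hN0 : N ≠ 0) (hev : Even N)
    (hx : IsTowerSequence K (N + 1) x) (hn : 1 ≤ n) :
    {Q : Place K (level K x n) | Q.IsRational ∧ Q.IsZero (levelSeq K x n 0 + 1)}.encard =
      1 + ∑ m ∈ Finset.Icc 1 n, (paramSet k K N (min m (n - m))).encard := by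
  have hfrob : ∀ a : Ω, (a + 1) ^ (N + 1) = a ^ (N + 1) + 1 :=
    hk ▸ add_one_pow_card ((algebraMap K Ω).comp (algebraMap k K))
  have H := hx.isTowerUpTo_levelSeq hN0 hfrob n
  have hnot : ∀ m ≤ n, ∀ Q ∈ rationalZeros k K x n m, ¬ Q.IsZero (levelSeq K x n m + 1) := by
    rintro m hm Q ⟨-, a, h0, h1, ha⟩ h
    have h2 := eq_of_valuation_sub_lt Q.valuation_algebraMap_le ha (d := -1)
      ((Q.isZero_add_one_iff _).mp h)
    rw [← map_one (algebraMap k K), ← map_neg] at h2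
    exact h1 ((algebraMap k K).injective h2)
  have hbelow : ∀ m ≤ n, ∀ Q ∈ rationalZeros k K x n m, ∀ i < m,
      Q.IsZero (levelSeq K x n i + 1) := by
    rintro m hm Q ⟨-, a, h0, h1, ha⟩ i hi
    exact valuation_add_one_lt_of_valuation_sub_lt H hN0 hev Q.valuation_algebraMap_le hm
        (pow_eq_one_of_ne_zero (algebraMap k K) hk h0) ha i hi
  rw [rationalPlaces_above_eq (k := k) hk hN0 hev hx hn, Set.encard_union_eq,
    encard_neg_one (k := k) hk hN0 hev hx hn,
    (Finset.finite_toSet _).encard_biUnion, finsum_mem_coe_finset]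
  · congr 1
    refine Finset.sum_congr rfl fun m hm => ?_
    rw [Finset.mem_Icc] at hm
    exact encard_rationalZeros hk hN0 hev hx hm.1 hm.2
  · intro m hm m' hm' hne
    rw [Finset.coe_Icc, Set.mem_Icc] at hm hm'
    refine Set.disjoint_left.mpr fun Q hQ hQ' => ?_
    rcases lt_or_gt_of_ne hne with h | h
    · exact hnot m hm.2 Q hQ (hbelow m' hm'.2 Q hQ' m h)
    · exact hnot m' hm'.2 Q hQ' (hbelow m hm.2 Q hQ m' h)
  · refine Set.disjoint_left.mpr ?_
    rintro Q ⟨-, hQ⟩ hQ'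
    simp only [Set.mem_iUnion, Finset.coe_Icc, Set.mem_Icc, exists_prop] at hQ'
    obtain ⟨m, ⟨hm1, hmn⟩, hQm⟩ := hQ'
    refine hnot m hmn Q hQm ?_
    rcases hmn.eq_or_lt with rfl | h
    · exact hQ
    · exact valuation_add_one_lt_of_valuation_sub_lt H hN0 hev Q.valuation_algebraMap_le le_rfl
        (α := -1) hev.neg_one_pow ((Q.isZero_add_one_iff _).mp hQ) m h

end Count

theorem sum_pow_two_Icc (l M : ℕ) :
    ∑ j ∈ Finset.Icc 1 M, (if j ≤ l then 2 ^ (j - 1) else 0) = 2 ^ min M l - 1 := by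
  induction M with
  | zero => simp
  | succ M ih =>
    rw [Finset.sum_Icc_succ_top (by omega), ih, Nat.add_sub_cancel]
    split_ifs with h
    · rw [min_eq_left (by omega), min_eq_left h, pow_succ]
      have := Nat.one_le_two_pow (n := M)
      omega
    · rw [min_eq_right (by omega), min_eq_right (by omega), add_zero]

/-- Folding the range `1, …, n` at its middle; `g 0` is the term for `m = n`. -/
theorem sum_min_Icc {n : ℕ} (hn : 1 ≤ n) (g : ℕ → ℕ) :
    ∑ m ∈ Finset.Icc 1 n, g (min m (n - m)) =
      ∑ j ∈ Finset.Icc 1 (n / 2), g j + ∑ j ∈ Finset.Icc 1 ((n - 1) / 2), g j + g 0 := by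
  obtain ⟨n, rfl⟩ : ∃ i, n = i + 1 := ⟨n - 1, by omega⟩
  rw [Finset.sum_Icc_succ_top (by omega), Nat.sub_self, min_eq_right (Nat.zero_le _)]
  congr 1
  have hd : Finset.Icc 1 n = Finset.Icc 1 ((n + 1) / 2) ∪ Finset.Ioc ((n + 1) / 2) n := by
    ext i
    simp only [Finset.mem_union, Finset.mem_Icc, Finset.mem_Ioc]
    omega
  rw [hd, Finset.sum_union]
  · congr 1
    · refine Finset.sum_congr rfl fun i hi => ?_
      rw [Finset.mem_Icc] at hi
      rw [min_eq_left (by omega)]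
    · refine Finset.sum_nbij' (fun i => n + 1 - i) (fun i => n + 1 - i) ?_ ?_ ?_ ?_ ?_
      · intro i hi
        simp only [Finset.mem_Icc, Finset.mem_Ioc] at hi ⊢
        omega
      · intro i hi
        simp only [Finset.mem_Icc, Finset.mem_Ioc] at hi ⊢
        omega
      · intro i hi
        simp only [Finset.mem_Ioc] at hi
        omega
      · intro i hi
        simp only [Finset.mem_Icc] at hi
        omega
      · intro i hi
        simp only [Finset.mem_Ioc] at hi
        rw [min_eq_right (by omega)]
  · refine Finset.disjoint_left.mpr fun i hi hi' => ?_
    simp only [Finset.mem_Icc, Finset.mem_Ioc] at hi hi'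
    omega

/-- Every zero of `x_0 + 1` in `F_n` restricts to a place of `F_0`. -/
theorem exists_liesAbove_iff {K Ω : Type*} [Field K] [Field Ω] [Algebra K Ω] {N n : ℕ}
    {x : ℕ → Ω} (hx : IsTowerSequence K (N + 1) x) (hN0 : N ≠ 0)
    (hfrob : ∀ a : Ω, (a + 1) ^ (N + 1) = a ^ (N + 1) + 1) (Q : Place K (level K x n)) :
    (∃ P : Place K (level K x 0), P.IsZero (gen K x le_rfl + 1) ∧
      Q.LiesAbove (baseEmbedding K x n) P) ↔ Q.IsZero (gen K x (Nat.zero_le n) + 1) := by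
  have hmap : (baseEmbedding K x n : level K x 0 →+* level K x n) (gen K x le_rfl + 1) =
      gen K x (Nat.zero_le n) + 1 := by
    rw [map_add, map_one]
    rfl
  have hval (P : Place K (level K x 0)) (hP : Q.LiesAbove (baseEmbedding K x n) P) :
      P.IsZero (gen K x le_rfl + 1) ↔ Q.IsZero (gen K x (Nat.zero_le n) + 1) := by
    rw [Place.IsZero, Place.IsZero, ← hP, valuation_comap_lt_one, hmap]
  constructor
  · rintro ⟨P, hP, hQP⟩
    exact (hval P hQP).mp hP
  · intro hQ
    have h0 : (gen K x le_rfl + 1 : level K x 0) ≠ 0 := fun h => by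
      have h1 : baseEmbedding K x n (gen K x le_rfl + 1) = 0 := by rw [h, map_zero]
      exact (hx.isTowerUpTo_levelSeq hN0 hfrob n).add_one_ne_zero (Nat.zero_le n) (by
        rw [← h1, show levelSeq K x n 0 = gen K x (Nat.zero_le n) from dif_pos _]
        exact hmap.symm)
    have hQ' : Q.ring.valuation (baseEmbedding K x n (gen K x le_rfl + 1)) < 1 := by
      rw [← AlgHom.coe_toRingHom, hmap]
      exact hQ
    let P := Place.ofValuationSubring (baseEmbedding K x n) Q.ring Q.valuation_algebraMap_le _ h0
      hQ'
    have hP : Q.LiesAbove (baseEmbedding K x n) P := rfl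
    exact ⟨P, (hval P hP).mpr hQ, hP⟩

end KummerTower

end

open KummerTower

theorem proposition2p7
    (k K Ω : Type*) [Field k] [Finite k] [Field K] [Algebra k K] [Field Ω] [Algebra K Ω]
    (q l : ℕ) (hk : Nat.card k = q) (hK : Nat.card K = q ^ 2) (hodd : Odd (ringChar k))
    (hl : 2 ^ l ∣ q + 1) (hl' : ¬ 2 ^ (l + 1) ∣ q + 1)
    (x : ℕ → Ω) (hx : KummerTower.IsTowerSequence K q x) (n : ℕ) (hn : 1 ≤ n) :
    -- the rational places of `F_n` that are zeros of `x_m - α`, `α ∈ F_q`, `α ≠ 0, -1`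
    (∀ (m : ℕ) (_ : 1 ≤ m) (hmn : m ≤ n) (S : Set (KummerTower.Place K (KummerTower.level K x n)))
      (_ : S = {Q | Q.IsRational ∧ ∃ α : k, α ≠ 0 ∧ α ≠ -1 ∧
        Q.IsZero (KummerTower.gen K x hmn - algebraMap K _ (algebraMap k K α))}),
      (2 * m ≤ n → m ≤ l → S.encard = ((2 ^ (m - 1) * (q - 1) : ℕ) : ℕ∞)) ∧
      (2 * m ≤ n → l < m → S.encard = 0) ∧
      (n < 2 * m → m < n → n - m ≤ l → S.encard = ((2 ^ (n - m - 1) * (q - 1) : ℕ) : ℕ∞)) ∧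
      (n < 2 * m → m < n → l < n - m → S.encard = 0) ∧
      (m = n → S.encard = ((q - 2 : ℕ) : ℕ∞))) ∧
    -- the rational places of `F_n` above the zero of `x_0 + 1` in `F_0`
    (∀ (T : Set (KummerTower.Place K (KummerTower.level K x n)))
      (_ : T = {Q | Q.IsRational ∧ ∃ P : KummerTower.Place K (KummerTower.level K x 0),
        P.IsZero (KummerTower.gen K x le_rfl + 1) ∧
        Q.LiesAbove (KummerTower.baseEmbedding K x n) P}),
      (2 * l < n → T.encard = (((q - 1) * (2 ^ (l + 1) - 1) : ℕ) : ℕ∞)) ∧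
      (n ≤ 2 * l → Odd n → T.encard = (((q - 1) * (2 ^ ((n + 1) / 2) - 1) : ℕ) : ℕ∞)) ∧
      (n ≤ 2 * l → Even n →
        T.encard = (((q - 1) * (3 * 2 ^ (n / 2 - 1) - 1) : ℕ) : ℕ∞))) := by 
  have hodd' : Odd q := hk ▸ odd_card hodd
  have h1k : 1 < q := hk ▸ Finite.one_lt_card
  obtain ⟨N, rfl⟩ : ∃ N, q = N + 1 := ⟨q - 1, by omega⟩
  have hN0 : N ≠ 0 := by omega
  have hev : Even N := by
    rcases Nat.even_or_odd N with h | h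
    · exact h
    · exact absurd hodd' (Nat.not_odd_iff_even.mpr h.add_one)
  have hKfin : Finite K := Nat.finite_of_card_ne_zero (by rw [hK]; positivity)
  rw [add_assoc] at hl hl'
  norm_num at hl hl'
  have hD := fun j => encard_paramSet (k := k) (K := K) (j := j) hN0 hk hK hev hl hl'
  have hgen : ∀ m (hmn : m ≤ n), gen K x hmn = levelSeq K x n m := fun m hmn =>
    Subtype.ext (coe_levelSeq hmn).symm
  refine ⟨?_, ?_⟩
  · intro m hm hmn S hS
    have hS' : S.encard = (paramSet k K N (min m (n - m))).encard := by
      rw [← encard_rationalZeros hk hN0 hev hx hm hmn, hS, hgen]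
      rfl
    rw [hS']
    refine ⟨fun h1 h2 => ?_, fun h1 h2 => ?_, fun h1 h2 h3 => ?_, fun h1 h2 h3 => ?_, fun h1 => ?_⟩
    · rw [min_eq_left (by omega)]
      exact (hD m).2.1 hm h2
    · rw [min_eq_left (by omega)]
      exact (hD m).2.2 hm h2
    · rw [min_eq_right (by omega)]
      exact (hD (n - m)).2.1 (by omega) h3
    · rw [min_eq_right (by omega)]
      exact (hD (n - m)).2.2 (by omega) h3
    · exact (hD _).1 (by omega)
  · intro T hT
    have hT' : T = {Q | Q.IsRational ∧ Q.IsZero (levelSeq K x n 0 + 1)} := by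
      rw [hT]
      ext Q
      refine and_congr_right fun _ => ?_
      rw [← hgen 0 (Nat.zero_le n)]
      exact exists_liesAbove_iff hx hN0 (hk ▸ add_one_pow_card
        ((algebraMap K Ω).comp (algebraMap k K))) Q
    have hsum : T.encard = ((N + N * (2 ^ min (n / 2) l - 1) +
        N * (2 ^ min ((n - 1) / 2) l - 1) : ℕ) : ℕ∞) := by
      let g : ℕ → ℕ := fun j => if j = 0 then N - 1 else N * if j ≤ l then 2 ^ (j - 1) else 0
      have hg : ∀ j, (paramSet k K N j).encard = (g j : ℕ∞) := by
        intro j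
        rcases Nat.eq_zero_or_pos j with h | h
        · rw [(hD j).1 h]
          simp [g, h]
        · rcases le_or_gt j l with h' | h'
          · rw [(hD j).2.1 h h']
            simp [g, h.ne', h', mul_comm]
          · rw [(hD j).2.2 h h']
            simp [g, h.ne', not_le.mpr h']
      have hgsum : ∀ M, ∑ j ∈ Finset.Icc 1 M, g j = N * (2 ^ min M l - 1) := by
        intro M
        rw [← sum_pow_two_Icc, Finset.mul_sum]
        refine Finset.sum_congr rfl fun j hj => if_neg ?_
        rw [Finset.mem_Icc] at hj
        omega
      rw [hT', encard_rationalPlaces_above (k := k) hk hN0 hev hx hn]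
      simp only [hg]
      rw [← Nat.cast_sum, sum_min_Icc hn g, hgsum, hgsum, ← Nat.cast_one, ← Nat.cast_add]
      congr 1
      have hg0 : g 0 = N - 1 := if_pos rfl
      rw [hg0]
      omega
    rw [hsum, Nat.add_sub_cancel]
    refine ⟨fun h => ?_, fun h h' => ?_, fun h h' => ?_⟩ <;> congr 1
    · rw [min_eq_right (by omega), min_eq_right (by omega)]
      obtain ⟨a, ha⟩ : ∃ a, 2 ^ l = a + 1 :=
        ⟨2 ^ l - 1, (Nat.sub_add_cancel Nat.one_le_two_pow).symm⟩
      rw [pow_succ, ha, Nat.add_sub_cancel, show (a + 1) * 2 - 1 = 2 * a + 1 by omega]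
      ring
    · obtain ⟨i, hi⟩ := h'
      rw [show n / 2 = i by omega, show (n - 1) / 2 = i by omega, show (n + 1) / 2 = i + 1 by omega,
        min_eq_left (by omega)]
      obtain ⟨a, ha⟩ : ∃ a, 2 ^ i = a + 1 :=
        ⟨2 ^ i - 1, (Nat.sub_add_cancel Nat.one_le_two_pow).symm⟩
      rw [pow_succ, ha, Nat.add_sub_cancel, show (a + 1) * 2 - 1 = 2 * a + 1 by omega]
      ring
    · obtain ⟨i, hi⟩ : ∃ i, n = 2 * (i + 1) := by
        obtain ⟨r, hr⟩ := h'
        exact ⟨r - 1, by omega⟩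
      rw [show n / 2 = i + 1 by omega, show (n - 1) / 2 = i by omega, min_eq_left (by omega),
        min_eq_left (by omega), Nat.add_sub_cancel]
      obtain ⟨a, ha⟩ : ∃ a, 2 ^ i = a + 1 :=
        ⟨2 ^ i - 1, (Nat.sub_add_cancel Nat.one_le_two_pow).symm⟩
      rw [pow_succ, ha, Nat.add_sub_cancel, show (a + 1) * 2 - 1 = 2 * a + 1 by omega,
        show 3 * (a + 1) - 1 = 3 * a + 2 by omega]
      ring
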